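/- **Setting.** Let $D\subset\mathbb R^2$ be a region with a finite conforming triangulation $\mathcal T^h$ (the fine grid), and let $\mathcal T^H=\{K_1,\dots,K_N\}$ be a coarse grid of $D$ of which $\mathcal T^h$ is a conforming refinement: each closed coarse block $K_i$ is a union of fine triangles, and each fine triangle lies in exactly one block. Let $h$ and $H$ be the largest diameters of a fine triangle and of a coarse block. Let $\kappa$ be measurable and bounded with $\kappa\ge 1$ on $D$, and let $f\in L^2(D)$. Write $\kappa_K=\max_K\kappa$ (up to null sets). The coarse edges $E\in\mathcal E^H$ are the interior edges $\partial K^+\cap\partial K^-$ of neighbouring blocks and the parts of the $\partial K_i$ on $\partial D$. Put $\overline\kappa=\tfrac12(\kappa_{K^+}+\kappa_{K^-})$ on interior edges, $\overline\kappa=\kappa_K$ on boundary edges, and let $\widetilde\kappa$ (on $K_i$) be the maximum of $\overline\kappa$ over the coarse edges on $\partial K_i$. *Spaces and flux.* $V_h(K_i)$ is the space of continuous functions on $K_i$ that are affine on each fine triangle, $V_h^0(K_i)$ the subspace of those vanishing on $\partial K_i$, $V_h(\partial K_i)$ the space of restrictions to $\partial K_i$, and $V^h_{DG}=\{v\in L^2(D):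 v|_{K_i}\in V_h(K_i)\ \forall i\}$. The harmonic extension $\widehat g\in V_h(K_i)$ of $g\in V_h(\partial K_i)$ satisfies $\widehat g=g$ on $\partial K_i$ and $\int_{K_i}\kappa\nabla\widehat g\cdot\nabla z=0$ for all $z\in V^0_h(K_i)$. The outward normal flux $\kappa\nabla u\cdot n_{\partial K_i}\in V_h(\partial K_i)$ is defined by $\int_{\partial K_i}(\kappa\nabla u\cdot n_{\partial K_i})\,g=\int_{K_i}\kappa\nabla u\cdot\nabla\widehat g$ for all $g\in V_h(\partial K_i)$. Let $C_{\rm inv}(\mathcal T^H,\mathcal T^h,\kappa)$ be the least constant $C\ge0$ in the inverse inequality $\int_{K_i}\kappa|\nabla\widehat g|^2\le\kappa_{K_i}C^2h^{-1}\int_{\partial K_i}g^2$ ($1\le i\le N$, $g\in V_h(\partial K_i)$). *Bilinear form.* With the usual jumps and averages (one-sided values on boundary edges) and penalty parameter $\gamma$, $$a_{DG}(u,v)=\sum_{i}\int_{K_i}\kappa\nabla u\cdot\nabla v-\sum_{E\in\mathcal E^H}\int_E\big(\{\!\{\kappa\nabla u\cdot n_E\}\!\}[\![v]\!]+\{\!\{\kappa\nabla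 v\cdot n_E\}\!\}[\![u]\!]\big)+\sum_{E\in\mathcal E^H}\frac{\gamma}{h}\int_E\overline\kappa[\![u]\!][\![v]\!],\qquad \|u\|_a^2=a_{DG}(u,u).$$ *Offline space.* $V_1^{i,\rm snap}$ is the span of the harmonic extensions of the nodal functions of the fine nodes on $\partial K_i$, and $V_2^{i,\rm snap}=V_h^0(K_i)$. Put $$\|v\|^2_{V_1(K_i)}=H^{-1}\int_{\partial K_i}\widetilde\kappa v^2,\qquad \|v\|^2_{V_2(K_i)}=H^{-2}\int_{K_i}\kappa v^2 .$$ Let $(\phi_k^{(i)},\lambda_{1,k}^{(i)})$ and $(\xi_k^{(i)},\lambda_{2,k}^{(i)})$ be complete lists (the eigenfunctions form a basis of the snapshot space) of eigenpairs, with eigenvalues in increasing order, repetitions being allowed, of $$\int_{K_i}\kappa\nabla\phi\cdot\nabla v=\frac{\lambda}{H}\int_{\partial K_i}\widetilde\kappa\phi v\quad\forall v\in V_1^{i,\rm snap},\qquad \int_{K_i}\kappa\nabla\xi\cdot\nabla v=\frac{\lambda}{H^2}\int_{K_i}\kappa\xi v\quad\forall v\in V_2^{i,\rm snap}.$$ Given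 numbers $l_{1,i},l_{2,i}$, the space $V^{\rm off}$ consists of the functions whose restriction to each $K_i$ lies in the span of the first $l_{1,i}$ functions $\phi_k^{(i)}$ and the first $l_{2,i}$ functions $\xi_k^{(i)}$. Put $\lambda^{(i)}_{j,l_{j,i}+1}=\infty$ if all eigenfunctions are used; the convention $1/0=\infty$, $0\cdot\infty=0$ is used if $\lambda^{(i)}_{j,l_{j,i}+1}=0$. *Solutions and residuals.* Let $u_h\in V^h_{DG}$ satisfy $a_{DG}(u_h,v)=(f,v)$ for all $v\in V^h_{DG}$, and let $u_H\in V^{\rm off}$ satisfy $a_{DG}(u_H,v)=(f,v)$ for all $v\in V^{\rm off}$. For $v\in V_j^{i,\rm snap}$, extended by zero outside $K_i$, put $R_{j,i}(v)=\int_{K_i}fv-a_{DG}(u_H,v)$, and $\|R_{j,i}\|=\sup_{v\in V_j^{i,\rm snap}}|R_{j,i}(v)|/\|v\|_{V_j(K_i)}$. **Theorem.** Let $C_{\rm inv}\ge 0$ and $\gamma>C_{\rm inv}^2$. There is a constant $C_{\rm err}>0$, depending only on $C_{\rm inv}$ and $\gamma$, such that for all grids and all $\kappa,f,l_{1,i},l_{2,i}$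 as above with $C_{\rm inv}(\mathcal T^H,\mathcal T^h,\kappa)\le C_{\rm inv}$, $$\|u_h-u_H\|_a^2\le C_{\rm err}\sum_{i=1}^N\sum_{j=1}^2\|R_{j,i}\|^2\big(\lambda^{(i)}_{j,l_{j,i}+1}\big)^{-1}.$$ -/

import Mathlib

open MeasureTheory Set
open scoped ENNReal Gradient

noncomputable section

namespace GMsDGM

/-- The Euclidean plane. -/
abbrev Plane : Type := EuclideanSpace ℝ (Fin 2)

/-- A fine grid together with a coarse grid of `N` blocks. The fine grid is a finite conforming
triangulation of a planar region: a finite simplicial complex all of whose simplices are faces of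
triangles. The coarse blocks are nonempty unions of fine triangles, every fine triangle lying in
exactly one block; so the fine grid is a conforming refinement of the coarse one. -/
structure TwoGrid (N : ℕ) where
  fine : Geometry.SimplicialComplex ℝ Plane
  finite_faces : fine.faces.Finite
  pure : ∀ s ∈ fine.faces, ∃ T ∈ fine.faces, s ⊆ T ∧ T.card = 3
  block : {T : Finset Plane // T ∈ fine.faces ∧ T.card = 3} → Fin N
  block_surjective : Function.Surjective block

/-- The integral over a piecewise linear curve `S`, with respect to arc length. -/
def lineIntegral (S : Set Plane) (w : Plane → ℝ) : ℝ :=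
  ∫ x in S, w x ∂(μH[1])

/-- The region covered by a set of simplices given by their vertices. -/
def carrier (F : Set (Finset Plane)) : Set Plane :=
  ⋃ s ∈ F, convexHull ℝ (s : Set Plane)

namespace TwoGrid

variable {N : ℕ} (G : TwoGrid N)

/-! ### Geometry of the two grids -/

/-- The fine triangles. -/
def triangles : Set (Finset Plane) := {T | T ∈ G.fine.faces ∧ T.card = 3}

/-- The fine triangles of the coarse block `i`. -/
def blockTriangles (i : Fin N) : Set (Finset Plane) :=
  {T | ∃ h : T ∈ G.fine.faces ∧ T.card = 3, G.block ⟨T, h⟩ = i}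

/-- The closure of the computational domain. -/
def closedDomain : Set Plane := carrier G.triangles

/-- The coarse grid block `K_i` (a closed set). -/
def K (i : Fin N) : Set Plane := carrier (G.blockTriangles i)

/-- The coarse mesh size: the largest diameter of a coarse block. -/
def H : ℝ := sSup (range fun i => Metric.diam (G.K i))

/-- The fine mesh size: the largest diameter of a fine triangle. -/
def h : ℝ := sSup ((fun T : Finset Plane => Metric.diam (convexHull ℝ (T : Set Plane))) '' G.triangles)

/-- The fine edges. -/
def edges : Set (Finset Plane) := {e | e ∈ G.fine.faces ∧ e.card = 2}

/-- The fine edges that lie on `∂K_i`: those that belong to exactly one triangle of the block. -/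
def bdryEdges (i : Fin N) : Set (Finset Plane) :=
  {e | e ∈ G.edges ∧ ∃! T, T ∈ G.blockTriangles i ∧ e ⊆ T}

/-- `∂K_i`. -/
def bdry (i : Fin N) : Set Plane := carrier (G.bdryEdges i)

/-- The fine grid nodes on `∂K_i`. -/
def bdryNodes (i : Fin N) : Set Plane := {p | ∃ e ∈ G.bdryEdges i, p ∈ e}

/-- The fine edges shared by the coarse blocks `i` and `j`, for `i ≠ j`. -/
def interEdges (i j : Fin N) : Set (Finset Plane) :=
  {e | e ∈ G.edges ∧ (∃ T ∈ G.blockTriangles i, e ⊆ T) ∧ ∃ T ∈ G.blockTriangles j, e ⊆ T}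

/-- The interior coarse edge between the coarse blocks `i` and `j`, for `i ≠ j`
(empty if the two blocks are not neighbours). -/
def interEdge (i j : Fin N) : Set Plane := carrier (G.interEdges i j)

/-- The fine edges on `∂D` (they belong to exactly one fine triangle) which lie on `∂K_i`. -/
def outerEdges (i : Fin N) : Set (Finset Plane) :=
  {e | e ∈ G.edges ∧ (∃! T, T ∈ G.triangles ∧ e ⊆ T) ∧ ∃ T ∈ G.blockTriangles i, e ⊆ T}

/-- The part of `∂K_i` that lies on `∂D`: the union of the boundary coarse edges of block `i`. -/
def outerEdge (i : Fin N) : Set Plane := carrier (G.outerEdges i)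

/-! ### Finite element spaces

A function on the block `K_i` is extended by zero to the plane. -/

/-- `V_h(K_i)`: the conforming piecewise linear finite element space on `K_i`. As a member is
single-valued on `K_i` and affine on every closed triangle, it is continuous on `K_i`. -/
def Vh (i : Fin N) : Submodule ℝ (Plane → ℝ) where
  carrier := {v | (∀ x, x ∉ G.K i → v x = 0) ∧
    ∀ T ∈ G.blockTriangles i, ∃ A : Plane →ᵃ[ℝ] ℝ, ∀ x ∈ convexHull ℝ (T : Set Plane), v x = A x}
  add_mem' := by
    rintro u v ⟨hu, hu'⟩ ⟨hv, hv'⟩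
    refine ⟨fun x hx => by simp [hu x hx, hv x hx], fun T hT => ?_⟩
    obtain ⟨A, hA⟩ := hu' T hT
    obtain ⟨B, hB⟩ := hv' T hT
    exact ⟨A + B, fun x hx => by simp [hA x hx, hB x hx]⟩
  zero_mem' := ⟨fun _ _ => rfl, fun _ _ => ⟨0, fun _ _ => rfl⟩⟩
  smul_mem' := by
    rintro c v ⟨hv, hv'⟩
    refine ⟨fun x hx => by simp [hv x hx], fun T hT => ?_⟩
    obtain ⟨A, hA⟩ := hv' T hT
    exact ⟨c • A, fun x hx => by simp [hA x hx]⟩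

/-- `V_h^0(K_i)`: the members of `V_h(K_i)` that vanish on `∂K_i`. -/
def Vh0 (i : Fin N) : Submodule ℝ (Plane → ℝ) where
  carrier := {v | v ∈ G.Vh i ∧ ∀ x ∈ G.bdry i, v x = 0}
  add_mem' := by
    rintro u v ⟨hu, hu'⟩ ⟨hv, hv'⟩
    exact ⟨add_mem hu hv, fun x hx => by simp [hu' x hx, hv' x hx]⟩
  zero_mem' := ⟨zero_mem _, fun _ _ => rfl⟩
  smul_mem' := by
    rintro c v ⟨hv, hv'⟩
    exact ⟨Submodule.smul_mem _ c hv, fun x hx => by simp [hv' x hx]⟩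

/-- `V_h(∂K_i)`: the restrictions to `∂K_i` of the members of `V_h(K_i)` (extended by zero). -/
def VhBdry (i : Fin N) : Set (Plane → ℝ) := {g | ∃ v ∈ G.Vh i, g = (G.bdry i).indicator v}

/-- `V_DG^h`: a function which belongs to `V_h(K_i)` on every coarse block is given by the family
of its restrictions to the blocks. -/
def VDG : Submodule ℝ (Fin N → Plane → ℝ) := Submodule.pi univ G.Vh

variable (κ : Plane → ℝ)

/-- `∫_{K_i} κ ∇u · ∇v`. The gradient of a piecewise linear function is taken pointwise; it exists
in the interior of every fine triangle, that is almost everywhere. -/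
def energy (i : Fin N) (u v : Plane → ℝ) : ℝ :=
  ∫ x in G.K i, κ x * inner ℝ (∇ u x) (∇ v x)

/-- `w` is the (discrete) harmonic extension to `K_i` of the boundary function `g`. -/
def IsHarmonicExtension (i : Fin N) (g w : Plane → ℝ) : Prop :=
  w ∈ G.Vh i ∧ (∀ z ∈ G.Vh0 i, G.energy κ i w z = 0) ∧ ∀ x ∈ G.bdry i, w x = g x

/-- The first local snapshot space: the span of the harmonic extensions of the boundary
functions that are one at one node of `∂K_i` and zero at the other ones. -/
def Vsnap1 (i : Fin N) : Submodule ℝ (Plane → ℝ) :=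
  Submodule.span ℝ {ψ | ∃ p ∈ G.bdryNodes i, ∃ δ ∈ G.VhBdry i,
    δ p = 1 ∧ (∀ q ∈ G.bdryNodes i, q ≠ p → δ q = 0) ∧ G.IsHarmonicExtension κ i δ ψ}

/-- The second local snapshot space. -/
def Vsnap2 (i : Fin N) : Submodule ℝ (Plane → ℝ) := G.Vh0 i

/-! ### Coefficients -/

/-- `κ_K`: the maximum of `κ` over the block `K_i` (up to null sets). -/
def kappaMax (i : Fin N) : ℝ := essSup κ (volume.restrict (G.K i))

/-- `κ̄` on the interior coarse edge between the blocks `i` and `j`. -/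
def kappaBar (i j : Fin N) : ℝ := (G.kappaMax κ i + G.kappaMax κ j) / 2

/-- `κ̃`: the maximum of `κ̄` over the coarse edges on `∂K_i`. On a boundary coarse edge `κ̄` is
`κ_K`. -/
def kappaTilde (i : Fin N) : ℝ :=
  sSup ({k | ∃ j, j ≠ i ∧ (G.interEdges i j).Nonempty ∧ k = G.kappaBar κ i j} ∪
    {k | (G.outerEdges i).Nonempty ∧ k = G.kappaMax κ i})

/-! ### Normal flux and the constant of the inverse inequality -/

/-- `q ∈ V_h(∂K_i)` is the outward normal flux `κ ∇u · n` on `∂K_i`: for every `g ∈ V_h(∂K_i)` with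
harmonic extension `w`, one has `∫_{∂K_i} q g = ∫_{K_i} κ ∇u · ∇w`. -/
def IsFlux (i : Fin N) (u q : Plane → ℝ) : Prop :=
  q ∈ G.VhBdry i ∧ ∀ g ∈ G.VhBdry i, ∀ w, G.IsHarmonicExtension κ i g w →
    lineIntegral (G.bdry i) (fun x => q x * g x) = G.energy κ i u w

/-- The outward normal flux `κ ∇u · n` on `∂K_i`. -/
def flux (i : Fin N) (u : Plane → ℝ) : Plane → ℝ := Classical.epsilon (G.IsFlux κ i u)

/-- The constant of the inverse inequality: the least `C ≥ 0` such that
`∫_K κ |∇w|² ≤ κ_K C² h⁻¹ ∫_{∂K} |g|²` for every coarse block `K` and every `g ∈ V_h(∂K)` with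
harmonic extension `w`. -/
def invConst : ℝ :=
  sInf {C : ℝ | 0 ≤ C ∧ ∀ i, ∀ g ∈ G.VhBdry i, ∀ w, G.IsHarmonicExtension κ i g w →
    G.energy κ i w w ≤ G.kappaMax κ i * C ^ 2 * G.h⁻¹ * lineIntegral (G.bdry i) (fun x => g x ^ 2)}

/-! ### The interior penalty form -/

/-- Jump over the interior coarse edge between blocks `i` and `j`, the normal pointing from `i`
to `j`. -/
def jump (u : Fin N → Plane → ℝ) (i j : Fin N) (x : Plane) : ℝ := u i x - u j x

/-- Average of `κ ∇u · n_E` on the interior coarse edge between blocks `i` and `j`, where `n_E`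
points from `i` to `j`; the outward normal of block `j` is `-n_E`. -/
def avgFlux (u : Fin N → Plane → ℝ) (i j : Fin N) (x : Plane) : ℝ :=
  (G.flux κ i (u i) x + -G.flux κ j (u j) x) / 2

/-- The bilinear form `a_DG` with penalty parameter `γ`. Interior coarse edges correspond to pairs
`i < j`. On boundary coarse edges the average and the jump are the one-sided values. -/
def aDG (γ : ℝ) (u v : Fin N → Plane → ℝ) : ℝ :=
  ∑ i, G.energy κ i (u i) (v i)
  - (∑ i, ∑ j ∈ Finset.Ioi i, lineIntegral (G.interEdge i j)
        (fun x => G.avgFlux κ u i j x * jump v i j x + G.avgFlux κ v i j x * jump u i j x)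
      + ∑ i, lineIntegral (G.outerEdge i)
        (fun x => G.flux κ i (u i) x * v i x + G.flux κ i (v i) x * u i x))
  + (∑ i, ∑ j ∈ Finset.Ioi i, γ / G.h * lineIntegral (G.interEdge i j)
        (fun x => G.kappaBar κ i j * jump u i j x * jump v i j x)
      + ∑ i, γ / G.h * lineIntegral (G.outerEdge i)
        (fun x => G.kappaMax κ i * u i x * v i x))

/-- `∫_{K_i} f v`. -/
def source (f : Plane → ℝ) (i : Fin N) (v : Plane → ℝ) : ℝ := ∫ x in G.K i, f x * v x

/-- `u` is the discontinuous Galerkin solution in the space `V`: `u ∈ V` and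
`a_DG(u, v) = (f, v)` for all `v ∈ V`. -/
def IsGalerkinSolution (γ : ℝ) (f : Plane → ℝ) (V : Submodule ℝ (Fin N → Plane → ℝ))
    (u : Fin N → Plane → ℝ) : Prop :=
  u ∈ V ∧ ∀ v ∈ V, G.aDG κ γ u v = ∑ i, G.source f i (v i)

/-! ### Local inner products and residuals -/

/-- The inner product `H⁻¹ ∫_{∂K_i} κ̃ u v` on the first snapshot space. -/
def form1 (i : Fin N) (u v : Plane → ℝ) : ℝ :=
  G.H⁻¹ * lineIntegral (G.bdry i) (fun x => G.kappaTilde κ i * u x * v x)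

/-- The inner product `H⁻² ∫_{K_i} κ u v` on the second snapshot space. -/
def form2 (i : Fin N) (u v : Plane → ℝ) : ℝ :=
  (G.H ^ 2)⁻¹ * ∫ x in G.K i, κ x * u x * v x

/-- The residual `v ↦ ∫_{K_i} f v - a_DG(u, v)`, where `v` is zero outside the block `i`. -/
def residual (γ : ℝ) (f : Plane → ℝ) (u : Fin N → Plane → ℝ) (i : Fin N) (v : Plane → ℝ) : ℝ :=
  G.source f i v - G.aDG κ γ u (Pi.single i v)

end TwoGrid

/-! ### Spectral problems, offline spaces and dual norms -/

/-- `(φ k, lam k)`, `k < M`, is a complete list of eigenpairs, with the eigenvalues in increasing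
order, of the problem: `φ ∈ V`, `a(φ, v) = lam * b(φ, v)` for all `v ∈ V`. -/
structure IsEigenbasis (V : Submodule ℝ (Plane → ℝ)) (a b : (Plane → ℝ) → (Plane → ℝ) → ℝ)
    {M : ℕ} (φ : Fin M → Plane → ℝ) (lam : Fin M → ℝ) : Prop where
  linearIndependent : LinearIndependent ℝ φ
  span_eq : Submodule.span ℝ (range φ) = V
  monotone : Monotone lam
  eigen : ∀ k, ∀ v ∈ V, a (φ k) v = lam k * b (φ k) v

/-- The span of the first `l` functions of a list. -/
def firstSpan {M : ℕ} (φ : Fin M → Plane → ℝ) (l : ℕ) : Submodule ℝ (Plane → ℝ) :=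
  Submodule.span ℝ {w | ∃ k : Fin M, (k : ℕ) < l ∧ w = φ k}

/-- The eigenvalue with number `l + 1` (counted from one), that is the first one which is not used
when `l` eigenfunctions are taken; it is infinite if all of them are used. -/
def nextEigenvalue {M : ℕ} (lam : Fin M → ℝ) (l : ℕ) : ℝ≥0∞ :=
  if hl : l < M then ENNReal.ofReal (lam ⟨l, hl⟩) else ⊤

/-- The offline space: on block `i` it is spanned by the first `l₁ i` functions of the first list
and the first `l₂ i` functions of the second one. -/
def Voff {N : ℕ} {M₁ M₂ : Fin N → ℕ} (φ : ∀ i, Fin (M₁ i) → Plane → ℝ)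
    (ξ : ∀ i, Fin (M₂ i) → Plane → ℝ) (l₁ l₂ : Fin N → ℕ) : Submodule ℝ (Fin N → Plane → ℝ) :=
  Submodule.pi univ fun i => firstSpan (φ i) (l₁ i) ⊔ firstSpan (ξ i) (l₂ i)

/-- The norm of the functional `R` on the space `V` with the norm `v ↦ b(v, v)^{1/2}`: the
supremum of `|R v| / b(v, v)^{1/2}` (in `[0, ∞]`, with `0 / 0 = 0`). -/
def dualNorm (V : Submodule ℝ (Plane → ℝ)) (b : (Plane → ℝ) → (Plane → ℝ) → ℝ)
    (R : (Plane → ℝ) → ℝ) : ℝ≥0∞ :=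
  ⨆ v ∈ V, ENNReal.ofReal |R v| / ENNReal.ofReal (Real.sqrt (b v v))

end GMsDGM

end

/-! Let `e = uh - uH`. By the equation for `uh`, the residual on block `i` is `R i v = a_DG(e, v)`,
with `v` extended by zero, so `a_DG(e, e) = ∑ R i (e i)` and it remains to estimate each residual by
the local energy.

On a block, `e i` splits into a discrete harmonic part and a part vanishing on the boundary,
orthogonal in energy and lying in the two snapshot spaces (`exists_snapshot_decomposition`). The
residual vanishes on the offline functions, so from each part `v` one may subtract its projection
onto the first eigenfunctions. The remainder `r` has no more energy than `v`, and `λ b(r, r) ≤ a(r,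
r)` for the next eigenvalue `λ` (`bilin_spectral_gap`). Hence `R(v)² ≤ X a(v, v)` with `X = ‖R‖²
λ⁻¹` (`sq_le_of_isEigenbasis`).

The other ingredient is coercivity, `c ∑ energy ≤ a_DG` with `c = 1 - C² / γ` (`aDG_coercive`).
Testing the flux with itself and using the inverse inequality bounds its boundary norm by the energy
(`lineIntegral_flux_sq_le`). Young's inequality then absorbs the consistency terms into penalty and
energy, since the coarse edges of a block overlap only in null sets; this rests on the fact that a
plane edge belongs to at most two triangles (`eq_of_common_edge`).

Young's inequality with weight `c` gives `2 a_DG(e, e) ≤ c⁻¹ ∑ X + c ∑ energy ≤ c⁻¹ ∑ X + a_DG(e,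
e)`, so the constant is `c⁻¹`. -/

noncomputable section
namespace GMsDGM

/-! ### Positive semidefinite forms on finite-dimensional spaces -/

section Bilinear

variable {E : Type*} [AddCommGroup E] [Module ℝ E] [FiniteDimensional ℝ E]

theorem exists_orthogonal_basis_of_symm (b : LinearMap.BilinForm ℝ E) (hs : ∀ x y, b x y = b y x) :
    ∃ e : Module.Basis (Fin (Module.finrank ℝ E)) ℝ E, ∀ i j, i ≠ j → b (e i) (e j) = 0 := by
  obtain ⟨e, he⟩ := LinearMap.BilinForm.exists_orthogonal_basis (B := b) ⟨hs⟩
  exact ⟨e, fun i j hij => he hij⟩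

theorem bilin_cauchy_schwarz {E : Type*} [AddCommGroup E] [Module ℝ E]
    (b : LinearMap.BilinForm ℝ E) (hs : ∀ x y, b x y = b y x)
    (hp : ∀ x, 0 ≤ b x x) (x y : E) : b x y ^ 2 ≤ b x x * b y y :=
  LinearMap.BilinForm.apply_sq_le_of_symm b hp ⟨hs⟩ x y

/-- A functional that vanishes on the kernel of a semidefinite form is represented by the form. -/
theorem bilin_exists_representative (b : LinearMap.BilinForm ℝ E) (hs : ∀ x y, b x y = b y x)
    (ℓ : E →ₗ[ℝ] ℝ) (hℓ : ∀ v, b v v = 0 → ℓ v = 0) : ∃ q, ∀ v, b q v = ℓ v := by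
  obtain ⟨e, he⟩ := exists_orthogonal_basis_of_symm b hs
  -- At a null basis vector the quotient is `0` by the convention for division, and the prescribed
  -- value `ℓ (e i)` is `0` as well.
  refine ⟨∑ i, (ℓ (e i) / b (e i) (e i)) • e i, fun v => ?_⟩
  suffices b (∑ i, (ℓ (e i) / b (e i) (e i)) • e i) = ℓ by rw [this]
  refine e.ext fun j => ?_
  simp only [map_sum, map_smul, LinearMap.sum_apply, LinearMap.smul_apply, smul_eq_mul]
  rw [Finset.sum_eq_single j (fun i _ hij => by rw [he i j hij, mul_zero]) (by simp)]
  by_cases h : b (e j) (e j) = 0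
  · rw [h, mul_zero, hℓ _ h]
  · field_simp

/-- A semidefinite form dominates every semidefinite form that vanishes on its kernel. -/
theorem bilin_exists_dominating (a b : LinearMap.BilinForm ℝ E)
    (has : ∀ x y, a x y = a y x) (hap : ∀ x, 0 ≤ a x x)
    (hbs : ∀ x y, b x y = b y x) (hbp : ∀ x, 0 ≤ b x x)
    (hab : ∀ x, b x x = 0 → a x x = 0) : ∃ C : ℝ, 0 ≤ C ∧ ∀ x, a x x ≤ C * b x x := by
  obtain ⟨e, he⟩ := exists_orthogonal_basis_of_symm b hbs
  have hdiv : ∀ i, 0 ≤ a (e i) (e i) / b (e i) (e i) := fun i => div_nonneg (hap _) (hbp _)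
  set n : ℝ := (Module.finrank ℝ E : ℝ) with hn
  have hn0 : 0 ≤ n := Nat.cast_nonneg _
  -- The factor `n` pays for discarding the off-diagonal entries of `a`; the sum of the quotients
  -- dominates each diagonal ratio. On null vectors of `b` the quotient is `0`, which is harmless as
  -- `a` vanishes there.
  refine ⟨n * ∑ i, a (e i) (e i) / b (e i) (e i),
    mul_nonneg hn0 (Finset.sum_nonneg fun i _ => hdiv i), fun x => ?_⟩
  have hx : x = ∑ i, e.repr x i • e i := (e.sum_repr x).symm
  set c := e.repr x
  have hb : b x x = ∑ i, c i ^ 2 * b (e i) (e i) := by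
    rw [hx]
    simp only [map_sum, map_smul, LinearMap.sum_apply, LinearMap.smul_apply, smul_eq_mul]
    refine Finset.sum_congr rfl fun i _ => ?_
    rw [Finset.sum_eq_single i (fun j _ hji => by rw [he j i hji]; ring) (by simp)]
    ring
  have hterm : ∀ i, c i ^ 2 * a (e i) (e i)
      = a (e i) (e i) / b (e i) (e i) * (c i ^ 2 * b (e i) (e i)) := by
    intro i
    by_cases h : b (e i) (e i) = 0
    · rw [hab _ h]; simp
    · field_simp
  have ha : a x x ≤ n * ∑ i, c i ^ 2 * a (e i) (e i) := by
    have h1 : a x x = ∑ i, ∑ j, c i * c j * a (e i) (e j) := by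
      rw [hx, Finset.sum_comm]
      simp only [map_sum, map_smul, LinearMap.sum_apply, LinearMap.smul_apply, smul_eq_mul,
        Finset.mul_sum]
      refine Finset.sum_congr rfl fun i _ => Finset.sum_congr rfl fun j _ => by ring
    -- This is nonnegativity of `a` at `c i • e i - c j • e j`.
    have h2 : ∀ i j, c i * c j * a (e i) (e j)
        ≤ (c i ^ 2 * a (e i) (e i) + c j ^ 2 * a (e j) (e j)) / 2 := by
      intro i j
      have := hap (c i • e i - c j • e j)
      simp only [map_sub, map_smul, LinearMap.sub_apply, LinearMap.smul_apply, smul_eq_mul] at this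
      rw [has (e j) (e i)] at this
      linarith
    rw [h1]
    refine (Finset.sum_le_sum fun i _ => Finset.sum_le_sum fun j _ => h2 i j).trans (le_of_eq ?_)
    simp only [← Finset.sum_div, Finset.sum_add_distrib, Finset.sum_const, Finset.card_univ,
      Fintype.card_fin, nsmul_eq_mul, ← Finset.mul_sum, ← hn]
    ring
  refine ha.trans ?_
  rw [mul_assoc]
  refine mul_le_mul_of_nonneg_left ?_ hn0
  rw [hb, Finset.mul_sum]
  refine Finset.sum_le_sum fun i _ => ?_
  rw [hterm i]
  refine mul_le_mul_of_nonneg_right ?_ (mul_nonneg (sq_nonneg _) (hbp _))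
  exact Finset.single_le_sum (f := fun i => a (e i) (e i) / b (e i) (e i))
    (fun i _ => hdiv i) (Finset.mem_univ i)

/-- The min-max bound for a vector orthogonal to the first eigenvectors. -/
theorem bilin_spectral_gap {E : Type*} [AddCommGroup E] [Module ℝ E]
    (a b : LinearMap.BilinForm ℝ E) (has : ∀ x y, a x y = a y x)
    (hbs : ∀ x y, b x y = b y x) (hbp : ∀ x, 0 ≤ b x x) {M : ℕ} (φ : Fin M → E)
    (lam : Fin M → ℝ) (hspan : ∀ v, v ∈ Submodule.span ℝ (range φ)) (hmono : Monotone lam)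
    (heig : ∀ k v, a (φ k) v = lam k * b (φ k) v) (l : Fin M) (r : E)
    (hr : ∀ k < l, b (φ k) r = 0) : lam l * b r r ≤ a r r := by
  obtain ⟨c, hc⟩ := (Submodule.mem_span_range_iff_exists_fun ℝ).1 (hspan r)
  have horth : ∀ k m, lam k ≠ lam m → b (φ k) (φ m) = 0 := by
    intro k m hkm
    have h1 := heig k (φ m)
    have h2 := heig m (φ k)
    rw [has, h1, hbs (φ m)] at h2
    have h3 : (lam k - lam m) * b (φ k) (φ m) = 0 := by linarith
    exact (mul_eq_zero.1 h3).resolve_left (sub_ne_zero.2 hkm)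
  have hexp : ∀ k, b (φ k) r = ∑ m, c m * b (φ k) (φ m) := by
    intro k
    rw [← hc]
    simp only [map_sum, map_smul, smul_eq_mul]
  have hleft : ∀ f : LinearMap.BilinForm ℝ E, f r r = ∑ k, c k * f (φ k) r := by
    intro f
    have : f r r = f (∑ k, c k • φ k) r := by rw [hc]
    rw [this]
    simp only [map_sum, map_smul, LinearMap.sum_apply, LinearMap.smul_apply, smul_eq_mul]
  -- The difference `a(r, r) - lam l * b(r, r)` is exhibited as `b(z, z)` with `z = ∑ c k s k φ k`.
  -- Eigenvectors of one eigenvalue need not be `b`-orthogonal, but there `s k = s m`, so the cross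
  -- terms match. For `k < l` the root is of a nonpositive number, hence `0`, in agreement with `b
  -- (φ k) r = 0`.
  set s : Fin M → ℝ := fun k => Real.sqrt (lam k - lam l)
  have key : a r r - lam l * b r r = b (∑ k, (c k * s k) • φ k) (∑ k, (c k * s k) • φ k) := by
    have h1 : b (∑ k, (c k * s k) • φ k) (∑ k, (c k * s k) • φ k)
        = ∑ k, ∑ m, c k * s k * (c m * s m * b (φ k) (φ m)) := by
      rw [Finset.sum_comm]
      simp only [map_sum, map_smul, LinearMap.sum_apply, LinearMap.smul_apply, smul_eq_mul,
        Finset.mul_sum]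
      refine Finset.sum_congr rfl fun i _ => Finset.sum_congr rfl fun j _ => by ring
    rw [h1, hleft a, hleft b, Finset.mul_sum, ← Finset.sum_sub_distrib]
    refine Finset.sum_congr rfl fun k _ => ?_
    rw [heig]
    rcases lt_or_ge k l with hk | hk
    · have : s k = 0 := Real.sqrt_eq_zero_of_nonpos (by linarith [hmono hk.le])
      simp [hr k hk, this]
    · have hsk : s k * s k = lam k - lam l := Real.mul_self_sqrt (by linarith [hmono hk])
      have : c k * (lam k * b (φ k) r) - lam l * (c k * b (φ k) r)
          = c k * (s k * s k) * b (φ k) r := by rw [hsk]; ring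
      rw [this, hexp, Finset.mul_sum]
      refine Finset.sum_congr rfl fun m _ => ?_
      by_cases hkm : lam k = lam m
      · have : s k = s m := by simp only [s, hkm]
        rw [this]; ring
      · rw [horth k m hkm]; ring
  linarith [hbp (∑ k, (c k * s k) • φ k)]

end Bilinear

/-! ### Semidefinite forms on subspaces, and projections. -/

/-- `b` is a symmetric positive semidefinite bilinear form on the subspace `V`. -/
structure IsPSDOn {X : Type*} [AddCommGroup X] [Module ℝ X] (V : Submodule ℝ X)
    (b : X → X → ℝ) : Prop where
  add_left : ∀ u ∈ V, ∀ v ∈ V, ∀ w ∈ V, b (u + v) w = b u w + b v w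
  smul_left : ∀ c : ℝ, ∀ u ∈ V, ∀ v ∈ V, b (c • u) v = c * b u v
  symm : ∀ u ∈ V, ∀ v ∈ V, b u v = b v u
  nonneg : ∀ u ∈ V, 0 ≤ b u u

namespace IsPSDOn

variable {X : Type*} [AddCommGroup X] [Module ℝ X] {V W : Submodule ℝ X} {a b : X → X → ℝ}

theorem mono (hb : IsPSDOn V b) (h : W ≤ V) : IsPSDOn W b :=
  ⟨fun u hu v hv w hw => hb.add_left u (h hu) v (h hv) w (h hw),
    fun c u hu v hv => hb.smul_left c u (h hu) v (h hv),
    fun u hu v hv => hb.symm u (h hu) v (h hv), fun u hu => hb.nonneg u (h hu)⟩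

/-- The form as a bilinear form on the subspace. -/
def toBilin (hb : IsPSDOn V b) : LinearMap.BilinForm ℝ V :=
  LinearMap.mk₂ ℝ (fun u v : V => b u v)
    (fun u v w => hb.add_left u u.2 v v.2 w w.2)
    (fun c u v => hb.smul_left c u u.2 v v.2)
    (fun u v w => by
      rw [hb.symm u u.2 _ (v + w).2, hb.symm u u.2 v v.2, hb.symm u u.2 w w.2]
      exact hb.add_left v v.2 w w.2 u u.2)
    (fun c u v => by
      rw [hb.symm u u.2 _ (c • v).2, hb.symm u u.2 v v.2]
      exact hb.smul_left c v v.2 u u.2)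

@[simp] theorem toBilin_apply (hb : IsPSDOn V b) (u v : V) : hb.toBilin u v = b u v := rfl

theorem toBilin_symm (hb : IsPSDOn V b) (u v : V) : hb.toBilin u v = hb.toBilin v u :=
  hb.symm u u.2 v v.2

theorem toBilin_nonneg (hb : IsPSDOn V b) (u : V) : 0 ≤ hb.toBilin u u := hb.nonneg u u.2

theorem add_right (hb : IsPSDOn V b) {u v w : X} (hu : u ∈ V) (hv : v ∈ V) (hw : w ∈ V) :
    b u (v + w) = b u v + b u w :=
  map_add (hb.toBilin ⟨u, hu⟩) ⟨v, hv⟩ ⟨w, hw⟩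

theorem sub_left (hb : IsPSDOn V b) {u v w : X} (hu : u ∈ V) (hv : v ∈ V) (hw : w ∈ V) :
    b (u - v) w = b u w - b v w :=
  LinearMap.map_sub₂ hb.toBilin ⟨u, hu⟩ ⟨v, hv⟩ ⟨w, hw⟩

theorem cauchy_schwarz (hb : IsPSDOn V b) {u v : X} (hu : u ∈ V) (hv : v ∈ V) :
    b u v ^ 2 ≤ b u u * b v v :=
  bilin_cauchy_schwarz hb.toBilin hb.toBilin_symm hb.toBilin_nonneg ⟨u, hu⟩ ⟨v, hv⟩

theorem eq_zero_of_self (hb : IsPSDOn V b) {u v : X} (hu : u ∈ V) (hv : v ∈ V)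
    (h : b v v = 0) : b u v = 0 := by
  have := hb.cauchy_schwarz hu hv
  rw [h, mul_zero] at this
  exact pow_eq_zero_iff two_ne_zero |>.1 (le_antisymm this (sq_nonneg _))

theorem add_self (hb : IsPSDOn V b) {u v : X} (hu : u ∈ V) (hv : v ∈ V) (h : b u v = 0) :
    b (u + v) (u + v) = b u u + b v v := by
  rw [hb.add_left u hu v hv _ (add_mem hu hv), hb.add_right hu hu hv, hb.add_right hv hu hv,
    hb.symm v hv u hu, h]
  ring

theorem exists_representative [FiniteDimensional ℝ V] (hb : IsPSDOn V b) (ℓ : V →ₗ[ℝ] ℝ)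
    (hℓ : ∀ v : V, b v v = 0 → ℓ v = 0) : ∃ q : V, ∀ v : V, b q v = ℓ v :=
  bilin_exists_representative hb.toBilin hb.toBilin_symm ℓ hℓ

theorem exists_dominating [FiniteDimensional ℝ V] (ha : IsPSDOn V a) (hb : IsPSDOn V b)
    (hab : ∀ v ∈ V, b v v = 0 → a v v = 0) : ∃ C : ℝ, 0 ≤ C ∧ ∀ v ∈ V, a v v ≤ C * b v v := by
  obtain ⟨C, hC, h⟩ := bilin_exists_dominating ha.toBilin hb.toBilin ha.toBilin_symm
    ha.toBilin_nonneg hb.toBilin_symm hb.toBilin_nonneg (fun v => hab v v.2)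
  exact ⟨C, hC, fun v hv => h ⟨v, hv⟩⟩

/-- By Cauchy–Schwarz `z ↦ b v z` vanishes on the null vectors in `W`, so it is represented by an
element of `W`. No definiteness is needed; the projection need not be unique. -/
theorem exists_projection [FiniteDimensional ℝ W] (hb : IsPSDOn V b) (h : W ≤ V) {v : X}
    (hv : v ∈ V) : ∃ p ∈ W, ∀ z ∈ W, b (v - p) z = 0 := by
  let ℓ : W →ₗ[ℝ] ℝ := (hb.toBilin ⟨v, hv⟩).comp (Submodule.inclusion h)
  obtain ⟨q, hq⟩ := (hb.mono h).exists_representative ℓ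
    (fun z hz => hb.eq_zero_of_self hv (h z.2) hz)
  refine ⟨q, q.2, fun z hz => ?_⟩
  rw [hb.sub_left hv (h q.2) (h hz), hq ⟨z, hz⟩]
  exact sub_self _

end IsPSDOn

/-! ### Dual norms and the spectral bound for functionals. -/

theorem firstSpan_le {V : Submodule ℝ (Plane → ℝ)} {M : ℕ} {φ : Fin M → Plane → ℝ}
    (h : Submodule.span ℝ (range φ) = V) (l : ℕ) : firstSpan φ l ≤ V := by
  rw [← h]
  refine Submodule.span_mono ?_
  rintro _ ⟨k, -, rfl⟩
  exact ⟨k, rfl⟩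

instance {M : ℕ} (φ : Fin M → Plane → ℝ) (l : ℕ) : FiniteDimensional ℝ (firstSpan φ l) := by
  refine FiniteDimensional.span_of_finite ℝ ((finite_range φ).subset ?_)
  rintro _ ⟨k, -, rfl⟩
  exact ⟨k, rfl⟩

/-- A vector with `b v v = 0` and `R v ≠ 0` would make the supremum infinite, so finiteness also
covers the degenerate vectors. -/
theorem abs_le_dualNorm {V : Submodule ℝ (Plane → ℝ)} {b : (Plane → ℝ) → (Plane → ℝ) → ℝ}
    {R : (Plane → ℝ) → ℝ} (hD : dualNorm V b R ≠ ⊤) {v : Plane → ℝ} (hv : v ∈ V) :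
    |R v| ≤ (dualNorm V b R).toReal * Real.sqrt (b v v) := by
  have h1 : ENNReal.ofReal |R v| / ENNReal.ofReal (Real.sqrt (b v v)) ≤ dualNorm V b R :=
    le_iSup₂ (f := fun v (_ : v ∈ V) =>
      ENNReal.ofReal |R v| / ENNReal.ofReal (Real.sqrt (b v v))) v hv
  rw [ENNReal.div_le_iff_le_mul (Or.inr hD) (Or.inl ENNReal.ofReal_ne_top)] at h1
  have h2 := ENNReal.toReal_mono (ENNReal.mul_ne_top hD ENNReal.ofReal_ne_top) h1
  rwa [ENNReal.toReal_ofReal (abs_nonneg _), ENNReal.toReal_mul,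
    ENNReal.toReal_ofReal (Real.sqrt_nonneg _)] at h2

/-- A functional that vanishes on the span of the first eigenfunctions is bounded in the energy
norm by its dual norm and the next eigenvalue. -/
theorem sq_le_of_isEigenbasis {V : Submodule ℝ (Plane → ℝ)}
    {a b : (Plane → ℝ) → (Plane → ℝ) → ℝ} (ha : IsPSDOn V a) (hb : IsPSDOn V b) {M : ℕ}
    {φ : Fin M → Plane → ℝ} {lam : Fin M → ℝ} (hφ : IsEigenbasis V a b φ lam) (l : ℕ)
    {R : (Plane → ℝ) → ℝ} (hR0 : R 0 = 0)
    (hR : ∀ v ∈ V, ∀ p ∈ firstSpan φ l, R (v - p) = R v)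
    (hX : dualNorm V b R ^ 2 * (nextEigenvalue lam l)⁻¹ ≠ ⊤) {v : Plane → ℝ} (hv : v ∈ V) :
    R v ^ 2 ≤ (dualNorm V b R ^ 2 * (nextEigenvalue lam l)⁻¹).toReal * a v v := by
  have hF := firstSpan_le hφ.span_eq l
  suffices R v = 0 ∨ R v ^ 2 ≤ (dualNorm V b R ^ 2 * (nextEigenvalue lam l)⁻¹).toReal * a v v by
    rcases this with h | h
    · rw [h, zero_pow two_ne_zero]
      exact mul_nonneg ENNReal.toReal_nonneg (ha.nonneg v hv)
    · exact h
  -- If all eigenfunctions are used, `v` itself may be subtracted from `v`, and `R v = R 0 = 0`.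
  by_cases hl : l < M
  swap
  · left
    have hvF : v ∈ firstSpan φ l := by
      rw [← hφ.span_eq] at hv
      refine Submodule.span_mono ?_ hv
      rintro _ ⟨k, rfl⟩
      exact ⟨k, by omega, rfl⟩
    rw [← hR v hv v hvF, sub_self, hR0]
  rw [nextEigenvalue, dif_pos hl] at hX ⊢
  set μ := lam ⟨l, hl⟩
  -- `ENNReal.ofReal` truncates to `0`, whose inverse is `⊤`; finiteness of the product then forces
  -- the dual norm to vanish.
  rcases le_or_gt μ 0 with hμ | hμ
  · left
    rw [ENNReal.ofReal_of_nonpos hμ, ENNReal.inv_zero] at hX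
    have hD : dualNorm V b R = 0 := by
      by_contra h
      exact hX (ENNReal.mul_top (pow_ne_zero 2 h))
    have := abs_le_dualNorm (by rw [hD]; exact ENNReal.zero_ne_top) hv
    rw [hD, ENNReal.toReal_zero, zero_mul] at this
    exact abs_eq_zero.1 (le_antisymm this (abs_nonneg _))
  right
  have hD : dualNorm V b R ≠ ⊤ := by
    intro h
    refine hX ?_
    rw [h, ENNReal.top_pow two_ne_zero, ENNReal.top_mul]
    exact ENNReal.inv_ne_zero.2 ENNReal.ofReal_ne_top
  obtain ⟨p, hp, hpz⟩ := hb.exists_projection hF hv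
  have hpV := hF hp
  have hrV := sub_mem hv hpV
  have hφV : ∀ k, φ k ∈ V := fun k => by
    rw [← hφ.span_eq]; exact Submodule.subset_span ⟨k, rfl⟩
  set r := v - p with hr
  have hbr : ∀ k : Fin M, (k : ℕ) < l → b (φ k) r = 0 := fun k hk => by
    rw [hb.symm _ (hφV k) _ hrV]
    exact hpz _ (Submodule.subset_span ⟨k, hk, rfl⟩)
  -- The eigenvalue equation turns `b`-orthogonality to the first eigenfunctions into
  -- `a`-orthogonality, so by Pythagoras passing from `v` to `r` does not increase the energy.
  have har : ∀ z ∈ firstSpan φ l, z ∈ V ∧ a z r = 0 := by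
    intro z hz
    induction hz using Submodule.span_induction with
    | mem x hx =>
      obtain ⟨k, hk, rfl⟩ := hx
      exact ⟨hφV k, by rw [hφ.eigen k r hrV, hbr k hk, mul_zero]⟩
    | zero => exact ⟨zero_mem _, by simpa using ha.smul_left 0 0 (zero_mem _) r hrV⟩
    | add x y _ _ hx hy =>
      exact ⟨add_mem hx.1 hy.1, by rw [ha.add_left x hx.1 y hy.1 r hrV, hx.2, hy.2, add_zero]⟩
    | smul c x _ hx =>
      exact ⟨V.smul_mem c hx.1, by rw [ha.smul_left c x hx.1 r hrV, hx.2, mul_zero]⟩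
  have hle : a r r ≤ a v v := by
    have h1 : v = p + r := by rw [hr]; abel
    rw [h1, ha.add_self hpV hrV (har p hp).2]
    linarith [ha.nonneg p hpV]
  have hgap : μ * b r r ≤ a r r := by
    refine bilin_spectral_gap ha.toBilin hb.toBilin ha.toBilin_symm hb.toBilin_symm
      hb.toBilin_nonneg (fun k => ⟨φ k, hφV k⟩) lam ?_ hφ.monotone
      (fun k w => hφ.eigen k w w.2) ⟨l, hl⟩ ⟨r, hrV⟩ (fun k hk => hbr k hk)
    rintro ⟨w, hw⟩
    rw [← hφ.span_eq] at hw
    obtain ⟨c, hc⟩ := (Submodule.mem_span_range_iff_exists_fun ℝ).1 hw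
    refine (Submodule.mem_span_range_iff_exists_fun ℝ).2 ⟨c, Subtype.ext ?_⟩
    simp [← hc]
  have hRr := abs_le_dualNorm hD hrV
  rw [hr, hR v hv p hp, ← hr] at hRr
  rw [ENNReal.toReal_mul, ENNReal.toReal_pow, ENNReal.toReal_inv, ENNReal.toReal_ofReal hμ.le]
  set D := (dualNorm V b R).toReal
  have hb0 := hb.nonneg r hrV
  calc R v ^ 2 = |R v| ^ 2 := (sq_abs _).symm
    _ ≤ (D * Real.sqrt (b r r)) ^ 2 := pow_le_pow_left₀ (abs_nonneg _) hRr 2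
    _ = D ^ 2 * b r r := by rw [mul_pow, Real.sq_sqrt hb0]
    _ = D ^ 2 * μ⁻¹ * (μ * b r r) := by field_simp
    _ ≤ D ^ 2 * μ⁻¹ * a v v :=
      mul_le_mul_of_nonneg_left (hgap.trans hle) (by positivity)

/-! ### Geometry of triangles and edges -/

theorem affineMap_eqOn_convexHull {A B : Plane →ᵃ[ℝ] ℝ} {S : Set Plane}
    (h : ∀ x ∈ S, A x = B x) : ∀ x ∈ convexHull ℝ S, A x = B x := by
  have hconv : Convex ℝ {x | A x = B x} := by
    intro x hx y hy s t _ _ hst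
    simp only [mem_ofPred_eq] at hx hy ⊢
    rw [Convex.combo_affine_apply hst, Convex.combo_affine_apply hst, hx, hy]
  exact fun x hx => convexHull_min (fun y hy => h y hy) hconv hx

/-- Three affinely independent points form an affine basis of the plane. The map `c p` is the
barycentric coordinate of the vertex `p`; for `p ∉ T` it has the junk value `0`. -/
theorem exists_barycentric {T : Finset Plane}
    (hT : AffineIndependent ℝ ((↑) : T → Plane)) (hc : T.card = 3) :
    affineSpan ℝ (T : Set Plane) = ⊤ ∧ ∃ c : Plane → (Plane →ᵃ[ℝ] ℝ),
      (∀ p ∈ T, ∀ q ∈ T, c p q = if q = p then 1 else 0) ∧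
      (∀ x, (∀ p ∈ T, 0 ≤ c p x) → x ∈ convexHull ℝ (T : Set Plane)) ∧
      ∀ A B : Plane →ᵃ[ℝ] ℝ, (∀ q ∈ T, A q = B q) → A = B := by
  classical
  have htop : affineSpan ℝ (range ((↑) : T → Plane)) = ⊤ := by
    rw [hT.affineSpan_eq_top_iff_card_eq_finrank_add_one]
    simp [hc]
  let b : AffineBasis T ℝ Plane := ⟨(↑), hT, htop⟩
  have hb : ∀ p (hp : p ∈ T), b ⟨p, hp⟩ = p := fun _ _ => rfl
  refine ⟨by simpa using htop, fun p => if h : p ∈ T then b.coord ⟨p, h⟩ else 0, ?_, ?_, ?_⟩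
  · intro p hp q hq
    simp only [dif_pos hp]
    rw [← hb q hq, b.coord_apply, hb q hq]
    simp only [Subtype.mk.injEq, eq_comm]
  · intro x hx
    have h1 := b.convexHull_eq_nonneg_coord
    have h2 : range b = (T : Set Plane) := by
      ext y
      constructor
      · rintro ⟨p, rfl⟩; exact p.2
      · intro hy; exact ⟨⟨y, hy⟩, rfl⟩
    rw [h2] at h1
    rw [h1]
    rintro ⟨p, hp⟩
    simpa only [dif_pos hp] using hx p hp
  · intro A B hAB
    refine AffineMap.ext_on htop ?_
    rintro _ ⟨p, rfl⟩
    exact hAB p p.2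

theorem exists_affineMap_interpolating {T : Finset Plane}
    (hT : AffineIndependent ℝ ((↑) : T → Plane)) (hc : T.card = 3) (val : Plane → ℝ) :
    ∃ A : Plane →ᵃ[ℝ] ℝ, ∀ q ∈ T, A q = val q := by
  obtain ⟨-, c, h, -, -⟩ := exists_barycentric hT hc
  refine ⟨∑ p ∈ T, val p • c p, fun q hq => ?_⟩
  have h1 : ∀ S : Finset Plane, (∑ p ∈ S, val p • c p : Plane →ᵃ[ℝ] ℝ) q
      = ∑ p ∈ S, val p * c p q := by
    classical
    intro S
    induction S using Finset.induction_on with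
    | empty => simp
    | insert a s ha ih => rw [Finset.sum_insert ha, Finset.sum_insert ha, ← ih]; rfl
  rw [h1, Finset.sum_eq_single q, h q hq q hq, if_pos rfl, mul_one]
  · intro p hp hpq
    rw [h p hp q hq, if_neg (Ne.symm hpq), mul_zero]
  · exact fun hq' => absurd hq hq'

theorem isCompact_hull (T : Finset Plane) : IsCompact (convexHull ℝ (T : Set Plane)) :=
  T.finite_toSet.isCompact_convexHull ℝ

theorem measurableSet_hull (T : Finset Plane) : MeasurableSet (convexHull ℝ (T : Set Plane)) :=
  (isCompact_hull T).isClosed.measurableSet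

theorem isClosed_carrier {F : Set (Finset Plane)} (hF : F.Finite) : IsClosed (carrier F) :=
  hF.isClosed_biUnion fun T _ => (isCompact_hull T).isClosed

theorem isCompact_carrier {F : Set (Finset Plane)} (hF : F.Finite) : IsCompact (carrier F) :=
  hF.isCompact_biUnion fun T _ => isCompact_hull T

theorem hull_subset_carrier {F : Set (Finset Plane)} {s : Finset Plane} (hs : s ∈ F) :
    convexHull ℝ (s : Set Plane) ⊆ carrier F :=
  subset_biUnion_of_mem (u := fun s : Finset Plane => convexHull ℝ (s : Set Plane)) hs

theorem carrier_mono {F F' : Set (Finset Plane)} (h : F ⊆ F') : carrier F ⊆ carrier F' :=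
  biUnion_subset_biUnion_left h

theorem hull_edge {e : Finset Plane} (he : e.card = 2) :
    ∃ p q : Plane, p ≠ q ∧ e = {p, q} ∧ convexHull ℝ (e : Set Plane) = segment ℝ p q := by
  obtain ⟨p, q, hpq, rfl⟩ := Finset.card_eq_two.1 he
  exact ⟨p, q, hpq, rfl, by simp [convexHull_pair]⟩

theorem hausdorffMeasure_hull_edge_lt_top {e : Finset Plane} (he : e.card = 2) :
    μH[1] (convexHull ℝ (e : Set Plane)) < ⊤ := by
  obtain ⟨p, q, -, -, h⟩ := hull_edge he
  rw [h, hausdorffMeasure_segment]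
  exact edist_lt_top _ _

/-- An affine function that vanishes almost everywhere on an edge vanishes on the edge. -/
theorem affineMap_eq_zero_of_ae_edge {e : Finset Plane} (he : e.card = 2) {A : Plane →ᵃ[ℝ] ℝ}
    (h : ∀ᵐ x ∂(μH[1].restrict (convexHull ℝ (e : Set Plane))), A x = 0) :
    ∀ x ∈ convexHull ℝ (e : Set Plane), A x = 0 := by
  obtain ⟨p, q, hpq, rfl, hseg⟩ := hull_edge he
  by_contra! hne
  obtain ⟨x₀, hx₀, hAx₀⟩ := hne
  -- An affine function with two zeros on a segment vanishes on all of it. One zero at most would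
  -- make the whole segment null, although its measure is its positive length.
  have hsub : (segment ℝ p q ∩ {x | A x = 0}).Subsingleton := by
    rintro x ⟨hx, hAx⟩ y ⟨hy, hAy⟩
    rw [segment_eq_image_lineMap] at hx hy
    obtain ⟨s, -, rfl⟩ := hx
    obtain ⟨t, -, rfl⟩ := hy
    simp only [mem_ofPred_eq, AffineMap.apply_lineMap] at hAx hAy
    rw [AffineMap.lineMap_apply_module'] at hAx hAy
    by_contra hst
    have hst' : s ≠ t := fun h => hst (by rw [h])
    simp only [smul_eq_mul] at hAx hAy
    have h1 : (s - t) * (A q - A p) = 0 := by linarith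
    have h2 : A q - A p = 0 := (mul_eq_zero.1 h1).resolve_left (sub_ne_zero.2 hst')
    rw [h2] at hAx
    have hp : A p = 0 := by linarith
    have hq : A q = 0 := by linarith
    rw [hseg, segment_eq_image_lineMap] at hx₀
    obtain ⟨r, -, rfl⟩ := hx₀
    apply hAx₀
    rw [AffineMap.apply_lineMap, hp, hq]
    simp
  have h0 : μH[1] (segment ℝ p q) = 0 := by
    rw [ae_restrict_iff' (measurableSet_hull _), hseg] at h
    refine measure_mono_null (t := {x | ¬ (x ∈ segment ℝ p q → A x = 0)} ∪
      (segment ℝ p q ∩ {x | A x = 0})) ?_ (measure_union_null h ?_)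
    · intro x hx
      by_cases hA : A x = 0
      · exact Or.inr ⟨hx, hA⟩
      · exact Or.inl fun h' => hA (h' hx)
    · have := Measure.nullSingletonClass_hausdorff Plane (d := 1) one_pos
      exact hsub.measure_zero _
  rw [hausdorffMeasure_segment, edist_eq_zero] at h0
  exact hpq h0

/-! ### Incidence and overlaps of triangles, edges and blocks. -/

namespace TwoGrid

variable {N : ℕ} (G : TwoGrid N)

theorem finite_triangles : G.triangles.Finite := G.finite_faces.subset fun _ h => h.1

theorem finite_edges : G.edges.Finite := G.finite_faces.subset fun _ h => h.1

theorem blockTriangles_subset (i : Fin N) : G.blockTriangles i ⊆ G.triangles := fun _ h => h.1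

theorem finite_blockTriangles (i : Fin N) : (G.blockTriangles i).Finite :=
  G.finite_triangles.subset (G.blockTriangles_subset i)

theorem bdryEdges_subset (i : Fin N) : G.bdryEdges i ⊆ G.edges := fun _ h => h.1

theorem interEdges_subset (i j : Fin N) : G.interEdges i j ⊆ G.edges := fun _ h => h.1

theorem outerEdges_subset (i : Fin N) : G.outerEdges i ⊆ G.edges := fun _ h => h.1

theorem blockTriangles_nonempty (i : Fin N) : (G.blockTriangles i).Nonempty := by
  obtain ⟨⟨T, hT⟩, h⟩ := G.block_surjective i
  exact ⟨T, hT, h⟩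

theorem eq_of_mem_blockTriangles {i j : Fin N} {T : Finset Plane} (hi : T ∈ G.blockTriangles i)
    (hj : T ∈ G.blockTriangles j) : i = j := by
  obtain ⟨_, rfl⟩ := hi
  obtain ⟨_, rfl⟩ := hj
  rfl

theorem isCompact_K (i : Fin N) : IsCompact (G.K i) :=
  isCompact_carrier (G.finite_blockTriangles i)

theorem measurableSet_K (i : Fin N) : MeasurableSet (G.K i) :=
  (G.isCompact_K i).isClosed.measurableSet

theorem K_subset_closedDomain (i : Fin N) : G.K i ⊆ G.closedDomain :=
  carrier_mono (G.blockTriangles_subset i)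

theorem interior_hull_nonempty {T : Finset Plane} (hT : T ∈ G.triangles) :
    (interior (convexHull ℝ (T : Set Plane))).Nonempty := by
  rw [interior_convexHull_nonempty_iff_affineSpan_eq_top]
  exact (exists_barycentric (G.fine.indep hT.1) hT.2).1

theorem volume_K_pos (i : Fin N) : 0 < volume (G.K i) := by
  obtain ⟨T, hT⟩ := G.blockTriangles_nonempty i
  have h1 := G.interior_hull_nonempty (G.blockTriangles_subset i hT)
  refine (isOpen_interior.measure_pos volume h1).trans_le (measure_mono ?_)
  exact interior_subset.trans (hull_subset_carrier hT)

/-- Almost every point of a block lies in the interior of one of its triangles. -/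
theorem ae_mem_interior (i : Fin N) : ∀ᵐ x ∂(volume.restrict (G.K i)),
    ∃ T ∈ G.blockTriangles i, x ∈ interior (convexHull ℝ (T : Set Plane)) := by
  rw [ae_restrict_iff' (G.measurableSet_K i)]
  have hnull : ∀ᵐ x ∂(volume : Measure Plane), ∀ T ∈ G.blockTriangles i,
      x ∉ frontier (convexHull ℝ (T : Set Plane)) := by
    rw [ae_ball_iff (G.finite_blockTriangles i).countable]
    intro T _
    exact measure_eq_zero_iff_ae_notMem.1 ((convex_convexHull ℝ _).addHaar_frontier volume)
  filter_upwards [hnull] with x hx hxK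
  obtain ⟨T, hT, hxT⟩ := mem_iUnion₂.1 hxK
  refine ⟨T, hT, ?_⟩
  by_contra h
  exact hx T hT ⟨subset_closure hxT, h⟩

/-- The index `i` supplies a triangle; with no triangles the supremum would be the default value
`0`. -/
theorem h_pos (i : Fin N) : 0 < G.h := by
  obtain ⟨T, hT⟩ := G.blockTriangles_nonempty i
  have hT' := G.blockTriangles_subset i hT
  obtain ⟨p, hp, q, hq, hpq⟩ := Finset.one_lt_card.1 (by rw [hT'.2]; norm_num : 1 < T.card)
  have h1 : dist p q ≤ Metric.diam (convexHull ℝ (T : Set Plane)) :=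
    Metric.dist_le_diam_of_mem (isCompact_hull T).isBounded
      (subset_convexHull ℝ _ hp) (subset_convexHull ℝ _ hq)
  refine (dist_pos.2 hpq).trans_le (h1.trans ?_)
  exact le_csSup (G.finite_triangles.image _).bddAbove ⟨T, hT', rfl⟩

theorem H_nonneg : 0 ≤ G.H := Real.sSup_nonneg (by rintro _ ⟨i, rfl⟩; exact Metric.diam_nonneg)

/-- Two simplices of the complex meet in the hull of their common vertices, and distinct edges share
at most one vertex. Hence edges overlap only in null sets of arc length. -/
theorem hull_inter_edges_subsingleton {e e' : Finset Plane} (he : e ∈ G.edges) (he' : e' ∈ G.edges)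
    (hne : e ≠ e') :
    (convexHull ℝ (e : Set Plane) ∩ convexHull ℝ (e' : Set Plane)).Subsingleton := by
  classical
  have h1 : (e ∩ e').card ≤ 1 := by
    by_contra! h
    have h2 : e ∩ e' = e := Finset.eq_of_subset_of_card_le Finset.inter_subset_left (by
      rw [he.2]; omega)
    have h3 : e ∩ e' = e' := Finset.eq_of_subset_of_card_le Finset.inter_subset_right (by
      rw [he'.2]; omega)
    exact hne (h2.symm.trans h3)
  have h2 : ((e : Set Plane) ∩ e').Subsingleton := by
    rw [← Finset.coe_inter]
    exact Finset.card_le_one_iff_subsingleton.1 h1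
  refine Set.Subsingleton.anti ?_ (G.fine.inter_subset_convexHull he.1 he'.1)
  rcases h2.eq_empty_or_singleton with h | ⟨x, h⟩
  · rw [h, convexHull_empty]; exact subsingleton_empty
  · rw [h, convexHull_singleton]; exact subsingleton_singleton

/-- Two triangles with a common edge lie on different sides of it. -/
theorem coord_neg_of_common_edge {e T T' : Finset Plane} {r r' : Plane} (he : e.card = 2)
    (hT : T ∈ G.triangles) (hT' : T' ∈ G.triangles) (hr : r ∉ e) (hr' : r' ∉ e)
    (hTr : ∀ x, x ∈ T ↔ x = r ∨ x ∈ e) (hTr' : ∀ x, x ∈ T' ↔ x = r' ∨ x ∈ e) (hne : r ≠ r')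
    {c c' : Plane →ᵃ[ℝ] ℝ} (hc : ∀ q ∈ T, c q = if q = r then 1 else 0)
    (hc' : ∀ q ∈ T', c' q = if q = r' then 1 else 0) : c r' < 0 := by
  obtain ⟨-, b, hb, hbT, hbext⟩ := exists_barycentric (G.fine.indep hT.1) hT.2
  obtain ⟨p, q, hpq, rfl⟩ := Finset.card_eq_two.1 he
  have hpT : p ∈ T := (hTr p).2 (by simp)
  have hqT : q ∈ T := (hTr q).2 (by simp)
  have hrT : r ∈ T := (hTr r).2 (by simp)
  have hpT' : p ∈ T' := (hTr' p).2 (by simp)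
  have hqT' : q ∈ T' := (hTr' q).2 (by simp)
  have hrT' : r' ∈ T' := (hTr' r').2 (by simp)
  have hrp : r ≠ p := fun h => hr (by simp [h])
  have hrq : r ≠ q := fun h => hr (by simp [h])
  have hrp' : r' ≠ p := fun h => hr' (by simp [h])
  have hrq' : r' ≠ q := fun h => hr' (by simp [h])
  have hcb : c = b r := hbext _ _ fun x hx => by rw [hc x hx, hb r hrT x hx]
  by_contra! hpos
  -- If `c r' ≥ 0`, the midpoint of the edge moved slightly towards `r'` stays in `T`. The choice of
  -- `δ` keeps the coordinates of `p` and `q`, which start at `1 / 2`, nonnegative.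
  set m : Plane := AffineMap.lineMap p q (1 / 2 : ℝ) with hm
  set δ : ℝ := (2 * (1 + |b p r'| + |b q r'|))⁻¹ with hδ
  have hden : (0 : ℝ) < 2 * (1 + |b p r'| + |b q r'|) := by positivity
  have hδ0 : 0 < δ := inv_pos.2 hden
  have hδm : δ * (2 * (1 + |b p r'| + |b q r'|)) = 1 := inv_mul_cancel₀ hden.ne'
  have hδ1 : δ ≤ 1 / 2 := by
    nlinarith [abs_nonneg (b p r'), abs_nonneg (b q r'),
      mul_nonneg hδ0.le (abs_nonneg (b p r')), mul_nonneg hδ0.le (abs_nonneg (b q r'))]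
  set x : Plane := AffineMap.lineMap m r' δ with hx
  have hval : ∀ A : Plane →ᵃ[ℝ] ℝ, A x = (1 - δ) * ((A p + A q) / 2) + δ * A r' := by
    intro A
    rw [hx, AffineMap.apply_lineMap, hm, AffineMap.apply_lineMap, AffineMap.lineMap_apply_module,
      AffineMap.lineMap_apply_module]
    simp only [smul_eq_mul]
    ring
  have hmT' : m ∈ convexHull ℝ (T' : Set Plane) :=
    (convex_convexHull ℝ _).lineMap_mem (subset_convexHull ℝ _ hpT')
      (subset_convexHull ℝ _ hqT') ⟨by norm_num, by norm_num⟩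
  have hxT' : x ∈ convexHull ℝ (T' : Set Plane) :=
    (convex_convexHull ℝ _).lineMap_mem hmT' (subset_convexHull ℝ _ hrT') ⟨hδ0.le, by linarith⟩
  have hxT : x ∈ convexHull ℝ (T : Set Plane) := by
    refine hbT x fun y hy => ?_
    rw [hval]
    rcases (hTr y).1 hy with rfl | hy'
    · rw [hb _ hrT p hpT, hb _ hrT q hqT, if_neg hrp.symm, if_neg hrq.symm, ← hcb]
      have := mul_nonneg hδ0.le hpos
      linarith
    · have habs : ∀ t : ℝ, -(δ * |t|) ≤ δ * t := fun t => by
        have := mul_le_mul_of_nonneg_left (neg_abs_le t) hδ0.le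
        linarith
      have h1 := mul_nonneg hδ0.le (abs_nonneg (b p r'))
      have h2 := mul_nonneg hδ0.le (abs_nonneg (b q r'))
      rw [Finset.mem_insert, Finset.mem_singleton] at hy'
      rcases hy' with rfl | rfl
      · rw [hb _ hpT _ hpT, hb _ hpT q hqT, if_pos rfl, if_neg hpq.symm]
        have := habs (b y r')
        linarith
      · rw [hb _ hqT p hpT, hb _ hqT _ hqT, if_pos rfl, if_neg hpq]
        have := habs (b y r')
        linarith
  -- The point `x` lies in both triangles, hence in the hull of their common vertices, where `c'` is
  -- zero. But `c' x = δ > 0`.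
  have hxe := G.fine.inter_subset_convexHull hT.1 hT'.1 ⟨hxT, hxT'⟩
  have hzero : ∀ y ∈ (T : Set Plane) ∩ (T' : Set Plane), c' y = (0 : Plane →ᵃ[ℝ] ℝ) y := by
    rintro y ⟨hy, hy'⟩
    rw [hc' y hy', if_neg]
    · rfl
    · rintro rfl
      rcases (hTr y).1 hy with h | h
      · exact hne h.symm
      · exact hr' h
  have h0 : c' x = 0 := affineMap_eqOn_convexHull hzero x hxe
  rw [hval, hc' p hpT', hc' q hqT', hc' r' hrT', if_neg hrp'.symm, if_neg hrq'.symm, if_pos rfl]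
    at h0
  linarith

theorem exists_opposite_vertex {e T : Finset Plane} (he : e.card = 2) (hT : T ∈ G.triangles)
    (heT : e ⊆ T) : ∃ r, r ∉ e ∧ ∀ x, x ∈ T ↔ x = r ∨ x ∈ e := by
  classical
  obtain ⟨r, hr⟩ := Finset.card_eq_one.1
    (show (T \ e).card = 1 by rw [Finset.card_sdiff_of_subset heT, he, hT.2])
  have hmem : ∀ x, (x ∈ T ∧ x ∉ e) ↔ x = r := fun x => by
    rw [← Finset.mem_sdiff, hr, Finset.mem_singleton]
  refine ⟨r, ((hmem r).2 rfl).2, fun x => ⟨fun hx => ?_, ?_⟩⟩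
  · by_cases hxe : x ∈ e
    · exact Or.inr hxe
    · exact Or.inl ((hmem x).1 ⟨hx, hxe⟩)
  · rintro (rfl | hx)
    · exact ((hmem x).2 rfl).1
    · exact heT hx

/-- In the plane an edge belongs to at most two triangles. -/
theorem eq_of_common_edge {e T₁ T₂ T₃ : Finset Plane} (he : e.card = 2) (h₁ : T₁ ∈ G.triangles)
    (h₂ : T₂ ∈ G.triangles) (h₃ : T₃ ∈ G.triangles) (he₁ : e ⊆ T₁) (he₂ : e ⊆ T₂) (he₃ : e ⊆ T₃)
    (h₁₂ : T₁ ≠ T₂) (h₁₃ : T₁ ≠ T₃) : T₂ = T₃ := by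
  by_contra h₂₃
  obtain ⟨r₁, hr₁, hT₁⟩ := G.exists_opposite_vertex he h₁ he₁
  obtain ⟨r₂, hr₂, hT₂⟩ := G.exists_opposite_vertex he h₂ he₂
  obtain ⟨r₃, hr₃, hT₃⟩ := G.exists_opposite_vertex he h₃ he₃
  have n₁₂ : r₁ ≠ r₂ := fun h => h₁₂ (by ext x; rw [hT₁, hT₂, h])
  have n₁₃ : r₁ ≠ r₃ := fun h => h₁₃ (by ext x; rw [hT₁, hT₃, h])
  have n₂₃ : r₂ ≠ r₃ := fun h => h₂₃ (by ext x; rw [hT₂, hT₃, h])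
  obtain ⟨-, b₁, hb₁, -, -⟩ := exists_barycentric (G.fine.indep h₁.1) h₁.2
  obtain ⟨-, b₂, hb₂, -, hext⟩ := exists_barycentric (G.fine.indep h₂.1) h₂.2
  obtain ⟨-, b₃, hb₃, -, -⟩ := exists_barycentric (G.fine.indep h₃.1) h₃.2
  have m₁ := (hT₁ r₁).2 (Or.inl rfl)
  have m₂ := (hT₂ r₂).2 (Or.inl rfl)
  have m₃ := (hT₃ r₃).2 (Or.inl rfl)
  have s₁₂ := G.coord_neg_of_common_edge he h₁ h₂ hr₁ hr₂ hT₁ hT₂ n₁₂ (hb₁ _ m₁) (hb₂ _ m₂)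
  have s₁₃ := G.coord_neg_of_common_edge he h₁ h₃ hr₁ hr₃ hT₁ hT₃ n₁₃ (hb₁ _ m₁) (hb₃ _ m₃)
  have s₂₃ := G.coord_neg_of_common_edge he h₂ h₃ hr₂ hr₃ hT₂ hT₃ n₂₃ (hb₂ _ m₂) (hb₃ _ m₃)
  -- Both coordinates vanish on the line of the edge, so they are proportional, with negative
  -- factor. Evaluation at `r₃` makes `b₁ r₁ r₃` a product of two negative numbers: three vertices
  -- cannot lie pairwise on opposite sides of a line.
  have heq : b₁ r₁ = (b₁ r₁ r₂) • b₂ r₂ := by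
    refine hext _ _ fun q hq => ?_
    rw [AffineMap.coe_smul, Pi.smul_apply, smul_eq_mul, hb₂ _ m₂ q hq]
    rcases (hT₂ q).1 hq with rfl | hqe
    · rw [if_pos rfl, mul_one]
    · rw [if_neg (fun h : q = r₂ => hr₂ (h ▸ hqe)), mul_zero, hb₁ _ m₁ q (he₁ hqe),
        if_neg (fun h : q = r₁ => hr₁ (h ▸ hqe))]
  have h3 : b₁ r₁ r₃ = b₁ r₁ r₂ * b₂ r₂ r₃ := by
    conv_lhs => rw [heq]
    rfl
  have := mul_pos_of_neg_of_neg s₁₂ s₂₃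
  linarith

theorem outerEdges_subset_bdryEdges (i : Fin N) : G.outerEdges i ⊆ G.bdryEdges i := by
  rintro e ⟨he, ⟨T, hT, huniq⟩, T', hT', heT'⟩
  exact ⟨he, T', ⟨hT', heT'⟩, fun S hS =>
    (huniq S ⟨G.blockTriangles_subset i hS.1, hS.2⟩).trans
      (huniq T' ⟨G.blockTriangles_subset i hT', heT'⟩).symm⟩

theorem interEdges_comm (i j : Fin N) : G.interEdges i j = G.interEdges j i := by
  ext e
  exact ⟨fun ⟨h, h1, h2⟩ => ⟨h, h2, h1⟩, fun ⟨h, h1, h2⟩ => ⟨h, h2, h1⟩⟩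

/-- Besides the triangle of block `j`, the edge has room for only one triangle of block `i`. -/
theorem interEdges_subset_bdryEdges {i j : Fin N} (hij : i ≠ j) :
    G.interEdges i j ⊆ G.bdryEdges i := by
  rintro e ⟨he, ⟨T, hT, heT⟩, T', hT', heT'⟩
  refine ⟨he, T, ⟨hT, heT⟩, fun S hS => ?_⟩
  have hne : ∀ S, S ∈ G.blockTriangles i → T' ≠ S := fun S hS h =>
    hij (G.eq_of_mem_blockTriangles hS (h ▸ hT'))
  exact G.eq_of_common_edge he.2 (G.blockTriangles_subset j hT') (G.blockTriangles_subset i hS.1)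
    (G.blockTriangles_subset i hT) heT' hS.2 heT (hne S hS.1) (hne T hT)

/-- A common edge would belong to triangles of three different blocks. -/
theorem disjoint_interEdges {i j k : Fin N} (hij : i ≠ j) (hik : i ≠ k) (hjk : j ≠ k) :
    Disjoint (G.interEdges i j) (G.interEdges i k) := by
  rw [Set.disjoint_left]
  rintro e ⟨he, ⟨T, hT, heT⟩, T', hT', heT'⟩ ⟨-, -, S, hS, heS⟩
  have h := G.eq_of_common_edge he.2 (G.blockTriangles_subset i hT)
    (G.blockTriangles_subset j hT') (G.blockTriangles_subset k hS) heT heT' heS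
    (fun h => hij (G.eq_of_mem_blockTriangles hT (h ▸ hT')))
    (fun h => hik (G.eq_of_mem_blockTriangles hT (h ▸ hS)))
  exact hjk (G.eq_of_mem_blockTriangles (h ▸ hT') hS)

theorem disjoint_outerEdges_interEdges {i j : Fin N} (hij : i ≠ j) :
    Disjoint (G.outerEdges i) (G.interEdges i j) := by
  rw [Set.disjoint_left]
  rintro e ⟨-, ⟨T₀, -, huniq⟩, -⟩ ⟨-, ⟨T, hT, heT⟩, T', hT', heT'⟩
  have h : T = T' := (huniq T ⟨G.blockTriangles_subset i hT, heT⟩).trans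
    (huniq T' ⟨G.blockTriangles_subset j hT', heT'⟩).symm
  exact hij (G.eq_of_mem_blockTriangles hT (h ▸ hT'))

theorem aedisjoint_carrier {F F' : Set (Finset Plane)} (hF : F ⊆ G.edges) (hF' : F' ⊆ G.edges)
    (h : Disjoint F F') : AEDisjoint (μH[1]) (carrier F) (carrier F') := by
  have hsub : carrier F ∩ carrier F' ⊆ ⋃ e ∈ F, ⋃ e' ∈ F',
      convexHull ℝ (e : Set Plane) ∩ convexHull ℝ (e' : Set Plane) := by
    rintro x ⟨hx, hx'⟩
    obtain ⟨e, he, hxe⟩ := mem_iUnion₂.1 hx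
    obtain ⟨e', he', hxe'⟩ := mem_iUnion₂.1 hx'
    exact mem_iUnion₂.2 ⟨e, he, mem_iUnion₂.2 ⟨e', he', hxe, hxe'⟩⟩
  have := Measure.nullSingletonClass_hausdorff Plane (d := 1) one_pos
  refine measure_mono_null hsub ?_
  rw [measure_biUnion_null_iff (G.finite_edges.subset hF).countable]
  intro e he
  rw [measure_biUnion_null_iff (G.finite_edges.subset hF').countable]
  intro e' he'
  refine (G.hull_inter_edges_subsingleton (hF he) (hF' he') ?_).measure_zero _
  rintro rfl
  exact Set.disjoint_left.1 h he he'

theorem hausdorffMeasure_carrier_lt_top {F : Set (Finset Plane)} (hF : F ⊆ G.edges) :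
    μH[1] (carrier F) < ⊤ :=
  measure_biUnion_lt_top (G.finite_edges.subset hF)
    fun _ he => hausdorffMeasure_hull_edge_lt_top (hF he).2

theorem measurableSet_carrier {F : Set (Finset Plane)} (hF : F ⊆ G.edges) :
    MeasurableSet (carrier F) :=
  (isClosed_carrier (G.finite_edges.subset hF)).measurableSet

end TwoGrid

/-! ### Bounded measurable functions and integrals over curves -/

/-- The space of bounded measurable functions on the plane. -/
def boundedMeasurable : Submodule ℝ (Plane → ℝ) where
  carrier := {u | Measurable u ∧ ∃ C : ℝ, ∀ x, |u x| ≤ C}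
  add_mem' := by
    rintro u v ⟨hu, C, hC⟩ ⟨hv, D, hD⟩
    exact ⟨hu.add hv, C + D, fun x => (abs_add_le _ _).trans (add_le_add (hC x) (hD x))⟩
  zero_mem' := ⟨measurable_const, 0, fun _ => by simp⟩
  smul_mem' := by
    rintro c u ⟨hu, C, hC⟩
    refine ⟨hu.const_smul c, |c| * C, fun x => ?_⟩
    rw [Pi.smul_apply, smul_eq_mul, abs_mul]
    exact mul_le_mul_of_nonneg_left (hC x) (abs_nonneg c)

theorem mul_mem_boundedMeasurable {u v : Plane → ℝ} (hu : u ∈ boundedMeasurable)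
    (hv : v ∈ boundedMeasurable) : (fun x => u x * v x) ∈ boundedMeasurable := by
  obtain ⟨hu, C, hC⟩ := hu
  obtain ⟨hv, D, hD⟩ := hv
  refine ⟨hu.mul hv, C * D, fun x => ?_⟩
  rw [abs_mul]
  exact mul_le_mul (hC x) (hD x) (abs_nonneg _) ((abs_nonneg _).trans (hC x))

theorem const_mul_mem_boundedMeasurable (c : ℝ) {u : Plane → ℝ} (hu : u ∈ boundedMeasurable) :
    (fun x => c * u x) ∈ boundedMeasurable := boundedMeasurable.smul_mem c hu

theorem sq_mem_boundedMeasurable {u : Plane → ℝ} (hu : u ∈ boundedMeasurable) :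
    (fun x => u x ^ 2) ∈ boundedMeasurable := by
  simpa only [sq] using mul_mem_boundedMeasurable hu hu

theorem indicator_mem_boundedMeasurable {S : Set Plane} (hS : MeasurableSet S) {u : Plane → ℝ}
    (hu : u ∈ boundedMeasurable) : S.indicator u ∈ boundedMeasurable := by
  obtain ⟨hu, C, hC⟩ := hu
  refine ⟨hu.indicator hS, C, fun x => ?_⟩
  by_cases hx : x ∈ S
  · rw [indicator_of_mem hx]; exact hC x
  · rw [indicator_of_notMem hx, abs_zero]; exact (abs_nonneg _).trans (hC x)

theorem integrableOn_of_boundedMeasurable {S : Set Plane} {μ : Measure Plane} (hS : μ S < ⊤)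
    {u : Plane → ℝ} (hu : u ∈ boundedMeasurable) : IntegrableOn u S μ := by
  obtain ⟨hu, C, hC⟩ := hu
  exact Measure.integrableOn_of_bounded hS.ne hu.aestronglyMeasurable
    (Filter.Eventually.of_forall hC)

section lineIntegral

variable {S : Set Plane} {u v w : Plane → ℝ}

theorem lineIntegral_add (hS : μH[1] S < ⊤) (hu : u ∈ boundedMeasurable)
    (hv : v ∈ boundedMeasurable) :
    lineIntegral S (fun x => u x + v x) = lineIntegral S u + lineIntegral S v :=
  integral_add (integrableOn_of_boundedMeasurable hS hu) (integrableOn_of_boundedMeasurable hS hv)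

theorem lineIntegral_sub (hS : μH[1] S < ⊤) (hu : u ∈ boundedMeasurable)
    (hv : v ∈ boundedMeasurable) :
    lineIntegral S (fun x => u x - v x) = lineIntegral S u - lineIntegral S v :=
  integral_sub (integrableOn_of_boundedMeasurable hS hu) (integrableOn_of_boundedMeasurable hS hv)

theorem lineIntegral_const_mul (c : ℝ) (u : Plane → ℝ) :
    lineIntegral S (fun x => c * u x) = c * lineIntegral S u := integral_const_mul c u

theorem lineIntegral_nonneg (h : ∀ x, 0 ≤ u x) : 0 ≤ lineIntegral S u := integral_nonneg h

theorem lineIntegral_mono (hS : μH[1] S < ⊤) (hu : u ∈ boundedMeasurable)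
    (hv : v ∈ boundedMeasurable) (h : ∀ x, u x ≤ v x) : lineIntegral S u ≤ lineIntegral S v :=
  integral_mono (integrableOn_of_boundedMeasurable hS hu)
    (integrableOn_of_boundedMeasurable hS hv) h

theorem lineIntegral_congr (hS : MeasurableSet S) (h : ∀ x ∈ S, u x = v x) :
    lineIntegral S u = lineIntegral S v := setIntegral_congr_fun hS h

theorem isPSDOn_lineIntegral (hS : μH[1] S < ⊤) :
    IsPSDOn boundedMeasurable (fun u v => lineIntegral S fun x => u x * v x) where
  add_left u hu v hv w hw := by
    rw [← lineIntegral_add hS (mul_mem_boundedMeasurable hu hw) (mul_mem_boundedMeasurable hv hw)]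
    simp only [Pi.add_apply, add_mul]
  smul_left c u _ v _ := by
    rw [← lineIntegral_const_mul]
    simp only [Pi.smul_apply, smul_eq_mul, mul_assoc]
  symm u _ v _ := by simp only [mul_comm]
  nonneg u _ := lineIntegral_nonneg fun x => mul_self_nonneg _

end lineIntegral

theorem IsPSDOn.const_mul {X : Type*} [AddCommGroup X] [Module ℝ X] {V : Submodule ℝ X}
    {b : X → X → ℝ} (hb : IsPSDOn V b) {c : ℝ} (hc : 0 ≤ c) :
    IsPSDOn V (fun u v => c * b u v) where
  add_left u hu v hv w hw := by rw [hb.add_left u hu v hv w hw, mul_add]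
  smul_left d u hu v hv := by rw [hb.smul_left d u hu v hv]; ring
  symm u hu v hv := by rw [hb.symm u hu v hv]
  nonneg u hu := mul_nonneg hc (hb.nonneg u hu)

namespace TwoGrid

variable {N : ℕ} (G : TwoGrid N)

/-! ### Finite element functions -/

/-- The extension by zero may jump at the boundary of the block, so measurability and boundedness
are obtained piecewise, from the finitely many compact triangles. -/
theorem Vh_le_boundedMeasurable (i : Fin N) : G.Vh i ≤ boundedMeasurable := by
  rintro v ⟨hv0, hv⟩
  choose! A hA using hv
  have hcont : ∀ T, Continuous (A T) := fun T => (A T).continuous_of_finiteDimensional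
  constructor
  · intro s hs
    have : v ⁻¹' s = ((G.K i)ᶜ ∩ {_x | (0 : ℝ) ∈ s}) ∪
        ⋃ T ∈ G.blockTriangles i, (convexHull ℝ (T : Set Plane) ∩ A T ⁻¹' s) := by
      ext x
      constructor
      · intro hx
        by_cases hxK : x ∈ G.K i
        · obtain ⟨T, hT, hxT⟩ := mem_iUnion₂.1 hxK
          refine Or.inr (mem_iUnion₂.2 ⟨T, hT, hxT, ?_⟩)
          rw [mem_preimage, ← hA T hT x hxT]
          exact hx
        · refine Or.inl ⟨hxK, ?_⟩
          rw [mem_preimage, hv0 x hxK] at hx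
          exact hx
      · rintro (⟨hxK, hx⟩ | hx)
        · rw [mem_preimage, hv0 x hxK]
          exact hx
        · obtain ⟨T, hT, hxT, hx⟩ := mem_iUnion₂.1 hx
          rw [mem_preimage, hA T hT x hxT]
          exact hx
    rw [this]
    refine ((G.measurableSet_K i).compl.inter (MeasurableSet.const _)).union ?_
    exact MeasurableSet.biUnion (G.finite_blockTriangles i).countable fun T _ =>
      (measurableSet_hull T).inter ((hcont T).measurable hs)
  · have hb : Bornology.IsBounded ({0} ∪ ⋃ T ∈ G.blockTriangles i,
        A T '' convexHull ℝ (T : Set Plane)) := by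
      refine Bornology.isBounded_singleton.union ?_
      rw [Bornology.isBounded_biUnion (G.finite_blockTriangles i)]
      exact fun T _ => ((isCompact_hull T).image (hcont T)).isBounded
    obtain ⟨C, hC⟩ := hb.exists_norm_le
    refine ⟨C, fun x => ?_⟩
    rw [← Real.norm_eq_abs]
    refine hC _ ?_
    by_cases hxK : x ∈ G.K i
    · obtain ⟨T, hT, hxT⟩ := mem_iUnion₂.1 hxK
      exact Or.inr (mem_iUnion₂.2 ⟨T, hT, x, hxT, (hA T hT x hxT).symm⟩)
    · exact Or.inl (hv0 x hxK)

/-- The fine grid nodes in a block. -/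
def blockNodes (i : Fin N) : Set Plane := ⋃ T ∈ G.blockTriangles i, (T : Set Plane)

theorem finite_blockNodes (i : Fin N) : (G.blockNodes i).Finite :=
  (G.finite_blockTriangles i).biUnion fun T _ => T.finite_toSet

theorem Vh_eq_zero_of_nodes {i : Fin N} {v : Plane → ℝ} (hv : v ∈ G.Vh i)
    (h : ∀ p ∈ G.blockNodes i, v p = 0) : v = 0 := by
  ext x
  by_cases hxK : x ∈ G.K i
  · obtain ⟨T, hT, hxT⟩ := mem_iUnion₂.1 hxK
    obtain ⟨A, hA⟩ := hv.2 T hT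
    rw [hA x hxT]
    refine affineMap_eqOn_convexHull (B := 0) (fun y hy => ?_) x hxT
    rw [← hA y (subset_convexHull ℝ _ hy)]
    exact h y (mem_iUnion₂.2 ⟨T, hT, hy⟩)
  · exact hv.1 x hxK

/-- A finite element function is determined by its finitely many nodal values. -/
instance finiteDimensional_Vh (i : Fin N) : FiniteDimensional ℝ (G.Vh i) := by
  have := (G.finite_blockNodes i).to_subtype
  let L : G.Vh i →ₗ[ℝ] (G.blockNodes i → ℝ) :=
    (LinearMap.funLeft ℝ ℝ (Subtype.val : G.blockNodes i → Plane)).comp (G.Vh i).subtype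
  refine FiniteDimensional.of_injective L ((injective_iff_map_eq_zero L).2 fun v hv => ?_)
  exact Subtype.ext (G.Vh_eq_zero_of_nodes v.2 fun p hp => congr_fun hv ⟨p, hp⟩)

/-- Nodal values can be prescribed. -/
theorem exists_Vh_interpolating (i : Fin N) (val : Plane → ℝ) :
    ∃ v ∈ G.Vh i, ∀ p ∈ G.blockNodes i, v p = val p := by
  classical
  have hex : ∀ T ∈ G.blockTriangles i, ∃ A : Plane →ᵃ[ℝ] ℝ, ∀ q ∈ T, A q = val q := fun T hT =>
    have h := G.blockTriangles_subset i hT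
    exists_affineMap_interpolating (G.fine.indep h.1) h.2 val
  choose! A hA using hex
  -- Conformity enters here: two triangles meet in the hull of their common vertices, where both
  -- interpolants have the same values.
  have hcompat : ∀ T ∈ G.blockTriangles i, ∀ T' ∈ G.blockTriangles i,
      ∀ x ∈ convexHull ℝ (T : Set Plane), x ∈ convexHull ℝ (T' : Set Plane) →
        A T x = A T' x := by
    intro T hT T' hT' x hx hx'
    refine affineMap_eqOn_convexHull (S := (T : Set Plane) ∩ T') (fun y hy => ?_) x
      (G.fine.inter_subset_convexHull (G.blockTriangles_subset i hT).1
        (G.blockTriangles_subset i hT').1 ⟨hx, hx'⟩)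
    rw [hA T hT y hy.1, hA T' hT' y hy.2]
  let v : Plane → ℝ := fun x =>
    if h : ∃ T ∈ G.blockTriangles i, x ∈ convexHull ℝ (T : Set Plane) then A h.choose x else 0
  have hv : ∀ T ∈ G.blockTriangles i, ∀ x ∈ convexHull ℝ (T : Set Plane), v x = A T x := by
    intro T hT x hx
    have h : ∃ T ∈ G.blockTriangles i, x ∈ convexHull ℝ (T : Set Plane) := ⟨T, hT, hx⟩
    simp only [v, dif_pos h]
    exact hcompat _ h.choose_spec.1 T hT x h.choose_spec.2 hx
  refine ⟨v, ⟨fun x hx => ?_, fun T hT => ⟨A T, hv T hT⟩⟩, fun p hp => ?_⟩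
  · exact dif_neg fun ⟨T, hT, hxT⟩ => hx (mem_iUnion₂.2 ⟨T, hT, hxT⟩)
  · obtain ⟨T, hT, hpT⟩ := mem_iUnion₂.1 hp
    rw [hv T hT p (subset_convexHull ℝ _ hpT), hA T hT p hpT]

/-! ### Traces on the boundary of a block -/

theorem bdryNodes_subset_blockNodes (i : Fin N) : G.bdryNodes i ⊆ G.blockNodes i := by
  rintro p ⟨e, ⟨-, T, ⟨hT, heT⟩, -⟩, hp⟩
  exact mem_iUnion₂.2 ⟨T, hT, heT hp⟩

theorem bdryNodes_subset_bdry (i : Fin N) : G.bdryNodes i ⊆ G.bdry i := by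
  rintro p ⟨e, he, hp⟩
  exact hull_subset_carrier he (subset_convexHull ℝ _ hp)

theorem finite_bdryNodes (i : Fin N) : (G.bdryNodes i).Finite :=
  (G.finite_blockNodes i).subset (G.bdryNodes_subset_blockNodes i)

theorem measurableSet_bdry (i : Fin N) : MeasurableSet (G.bdry i) :=
  G.measurableSet_carrier (G.bdryEdges_subset i)

theorem bdry_lt_top (i : Fin N) : μH[1] (G.bdry i) < ⊤ :=
  G.hausdorffMeasure_carrier_lt_top (G.bdryEdges_subset i)

theorem Vh_affine_on_bdryEdge {i : Fin N} {v : Plane → ℝ} (hv : v ∈ G.Vh i) {e : Finset Plane}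
    (he : e ∈ G.bdryEdges i) :
    ∃ A : Plane →ᵃ[ℝ] ℝ, ∀ x ∈ convexHull ℝ (e : Set Plane), v x = A x := by
  obtain ⟨-, T, ⟨hT, heT⟩, -⟩ := he
  obtain ⟨A, hA⟩ := hv.2 T hT
  exact ⟨A, fun x hx => hA x (convexHull_mono (by exact_mod_cast heT) hx)⟩

theorem Vh_eq_on_bdry_of_nodes {i : Fin N} {u v : Plane → ℝ} (hu : u ∈ G.Vh i) (hv : v ∈ G.Vh i)
    (h : ∀ p ∈ G.bdryNodes i, u p = v p) : ∀ x ∈ G.bdry i, u x = v x := by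
  intro x hx
  obtain ⟨e, he, hxe⟩ := mem_iUnion₂.1 hx
  obtain ⟨A, hA⟩ := G.Vh_affine_on_bdryEdge hu he
  obtain ⟨B, hB⟩ := G.Vh_affine_on_bdryEdge hv he
  rw [hA x hxe, hB x hxe]
  refine affineMap_eqOn_convexHull (fun y hy => ?_) x hxe
  have hy' := subset_convexHull ℝ (e : Set Plane) hy
  rw [← hA y hy', ← hB y hy']
  exact h y ⟨e, he, hy⟩

/-- The boundary form is definite on traces: a function vanishing almost everywhere on an edge and
affine there vanishes on the whole edge. -/
theorem Vh_eq_zero_on_bdry {i : Fin N} {v : Plane → ℝ} (hv : v ∈ G.Vh i)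
    (h : lineIntegral (G.bdry i) (fun x => v x * v x) = 0) : ∀ x ∈ G.bdry i, v x = 0 := by
  have hbm := G.Vh_le_boundedMeasurable i hv
  have hae : ∀ᵐ x ∂(μH[1].restrict (G.bdry i)), v x * v x = 0 :=
    (integral_eq_zero_iff_of_nonneg (fun x => mul_self_nonneg _)
      (integrableOn_of_boundedMeasurable (G.bdry_lt_top i)
        (mul_mem_boundedMeasurable hbm hbm))).1 h
  intro x hx
  obtain ⟨e, he, hxe⟩ := mem_iUnion₂.1 hx
  obtain ⟨A, hA⟩ := G.Vh_affine_on_bdryEdge hv he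
  rw [hA x hxe]
  refine affineMap_eq_zero_of_ae_edge (G.bdryEdges_subset i he).2 ?_ x hxe
  have hae' := ae_restrict_of_ae_restrict_of_subset (hull_subset_carrier he) hae
  filter_upwards [hae', ae_restrict_mem (measurableSet_hull e)] with y hy hye
  rw [← hA y hye]
  exact mul_self_eq_zero.1 hy

/-! ### Coefficients -/

/-- `κ` is measurable and bounded on the domain with `κ ≥ 1`. -/
structure IsCoefficient (κ : Plane → ℝ) : Prop where
  aestronglyMeasurable : AEStronglyMeasurable κ (volume.restrict G.closedDomain)
  one_le : ∀ᵐ x ∂(volume.restrict G.closedDomain), 1 ≤ κ x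
  le_bound : ∃ B : ℝ, ∀ᵐ x ∂(volume.restrict G.closedDomain), κ x ≤ B

variable {G} {κ : Plane → ℝ}

theorem IsCoefficient.aestronglyMeasurable_K (hκ : G.IsCoefficient κ) (i : Fin N) :
    AEStronglyMeasurable κ (volume.restrict (G.K i)) :=
  hκ.aestronglyMeasurable.mono_measure (Measure.restrict_mono (G.K_subset_closedDomain i) le_rfl)

theorem IsCoefficient.one_le_K (hκ : G.IsCoefficient κ) (i : Fin N) :
    ∀ᵐ x ∂(volume.restrict (G.K i)), 1 ≤ κ x :=
  ae_restrict_of_ae_restrict_of_subset (G.K_subset_closedDomain i) hκ.one_le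

theorem IsCoefficient.exists_bound_K (hκ : G.IsCoefficient κ) (i : Fin N) :
    ∃ B : ℝ, ∀ᵐ x ∂(volume.restrict (G.K i)), κ x ≤ B :=
  hκ.le_bound.imp fun _ h => ae_restrict_of_ae_restrict_of_subset (G.K_subset_closedDomain i) h

/-- Bounded functions times the coefficient are integrable on a block. -/
theorem IsCoefficient.integrableOn_mul (hκ : G.IsCoefficient κ) (i : Fin N) {g : Plane → ℝ}
    (hg : AEStronglyMeasurable g (volume.restrict (G.K i)))
    (hC : ∃ C : ℝ, ∀ᵐ x ∂(volume.restrict (G.K i)), |g x| ≤ C) :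
    IntegrableOn (fun x => κ x * g x) (G.K i) := by
  obtain ⟨B, hB⟩ := hκ.exists_bound_K i
  obtain ⟨C, hC⟩ := hC
  have hfin : volume (G.K i) ≠ ⊤ := (G.isCompact_K i).measure_lt_top.ne
  refine (integrableOn_const (C := |B| * C) hfin).mono'
    ((hκ.aestronglyMeasurable_K i).mul hg) ?_
  filter_upwards [hB, hκ.one_le_K i, hC] with x h1 h2 h3
  rw [Real.norm_eq_abs, abs_mul]
  refine mul_le_mul ?_ h3 (abs_nonneg _) (abs_nonneg _)
  rw [abs_of_nonneg (by linarith)]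
  exact h1.trans (le_abs_self B)

theorem IsCoefficient.one_le_kappaMax (hκ : G.IsCoefficient κ) (i : Fin N) :
    1 ≤ G.kappaMax κ i := by
  have hne : volume.restrict (G.K i) ≠ 0 := by
    rw [Ne, Measure.restrict_eq_zero]
    exact (G.volume_K_pos i).ne'
  obtain ⟨B, hB⟩ := hκ.exists_bound_K i
  have : (ae (volume.restrict (G.K i))).NeBot := ae_neBot.2 hne
  rw [← essSup_const (1 : ℝ) hne]
  exact essSup_mono_ae (hκ.one_le_K i)
    (Filter.isBoundedUnder_const.isCoboundedUnder_le) ⟨B, Filter.eventually_map.2 hB⟩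

theorem IsCoefficient.kappaMax_pos (hκ : G.IsCoefficient κ) (i : Fin N) : 0 < G.kappaMax κ i :=
  one_pos.trans_le (hκ.one_le_kappaMax i)

theorem IsCoefficient.kappaTilde_nonneg (hκ : G.IsCoefficient κ) (i : Fin N) :
    0 ≤ G.kappaTilde κ i := by
  refine Real.sSup_nonneg ?_
  rintro _ (⟨j, -, -, rfl⟩ | ⟨-, rfl⟩)
  · have h1 := hκ.kappaMax_pos i
    have h2 := hκ.kappaMax_pos j
    rw [kappaBar]
    positivity
  · exact (hκ.kappaMax_pos i).le

/-! ### The local forms -/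

theorem IsCoefficient.isPSDOn_form1 (hκ : G.IsCoefficient κ) (i : Fin N) :
    IsPSDOn boundedMeasurable (G.form1 κ i) := by
  have h := (isPSDOn_lineIntegral (G.bdry_lt_top i)).const_mul
    (mul_nonneg (inv_nonneg.2 G.H_nonneg) (hκ.kappaTilde_nonneg i))
  have heq : G.form1 κ i = fun u v => G.H⁻¹ * G.kappaTilde κ i *
      lineIntegral (G.bdry i) fun x => u x * v x := by
    funext u v
    simp only [form1, mul_assoc, lineIntegral_const_mul]
  rwa [heq]

theorem IsCoefficient.isPSDOn_form2 (hκ : G.IsCoefficient κ) (i : Fin N) :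
    IsPSDOn boundedMeasurable (G.form2 κ i) := by
  refine IsPSDOn.const_mul (b := fun (u v : Plane → ℝ) => ∫ x in G.K i, κ x * u x * v x) ?_
    (inv_nonneg.2 (sq_nonneg _))
  have hint : ∀ u ∈ boundedMeasurable, ∀ v ∈ boundedMeasurable,
      IntegrableOn (fun x => κ x * u x * v x) (G.K i) := by
    intro u hu v hv
    obtain ⟨hm, C, hC⟩ := mul_mem_boundedMeasurable hu hv
    simp only [mul_assoc]
    exact hκ.integrableOn_mul i hm.aestronglyMeasurable ⟨C, Filter.Eventually.of_forall hC⟩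
  refine ⟨fun u hu v hv w hw => ?_, fun c u _ v _ => ?_, fun u _ v _ => ?_, fun u _ => ?_⟩
  · rw [← integral_add (hint u hu w hw) (hint v hv w hw)]
    simp only [Pi.add_apply, mul_add, add_mul]
  · rw [← integral_const_mul]
    refine integral_congr_ae (Filter.Eventually.of_forall fun x => ?_)
    simp only [Pi.smul_apply, smul_eq_mul]
    ring
  · refine integral_congr_ae (Filter.Eventually.of_forall fun x => ?_)
    simp only
    ring
  · refine integral_nonneg_of_ae ?_
    filter_upwards [hκ.one_le_K i] with x hx
    rw [mul_assoc]
    exact mul_nonneg (by linarith) (mul_self_nonneg _)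

theorem affineMap_hasFDerivAt (A : Plane →ᵃ[ℝ] ℝ) (x : Plane) :
    HasFDerivAt A (LinearMap.toContinuousLinearMap A.linear) x := by
  have h := (LinearMap.toContinuousLinearMap A.linear).hasFDerivAt (x := x) |>.add_const (A 0)
  refine h.congr_of_eventuallyEq (Filter.Eventually.of_forall fun y => ?_)
  exact congr_fun A.decomp y

theorem ae_differentiableAt_Vh {i : Fin N} {v : Plane → ℝ} (hv : v ∈ G.Vh i) :
    ∀ᵐ x ∂(volume.restrict (G.K i)), DifferentiableAt ℝ v x := by
  filter_upwards [G.ae_mem_interior i] with x ⟨T, hT, hx⟩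
  obtain ⟨A, hA⟩ := hv.2 T hT
  have heq : v =ᶠ[nhds x] A := by
    filter_upwards [isOpen_interior.mem_nhds hx] with y hy
    exact hA y (interior_subset hy)
  exact heq.differentiableAt_iff.2 (affineMap_hasFDerivAt A x).differentiableAt

theorem ae_norm_gradient_le_Vh {i : Fin N} {v : Plane → ℝ} (hv : v ∈ G.Vh i) :
    ∃ C : ℝ, ∀ᵐ x ∂(volume.restrict (G.K i)), ‖∇ v x‖ ≤ C := by
  have hex := hv.2
  choose! A hA using hex
  obtain ⟨C, hC⟩ := ((G.finite_blockTriangles i).image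
    fun T => ‖LinearMap.toContinuousLinearMap (A T).linear‖).bddAbove
  refine ⟨C, ?_⟩
  filter_upwards [G.ae_mem_interior i] with x ⟨T, hT, hx⟩
  have heq : v =ᶠ[nhds x] A T := by
    filter_upwards [isOpen_interior.mem_nhds hx] with y hy
    exact hA T hT y (interior_subset hy)
  rw [gradient, LinearIsometryEquiv.norm_map, heq.fderiv_eq, (affineMap_hasFDerivAt (A T) x).fderiv]
  exact hC ⟨T, hT, rfl⟩

theorem measurable_gradient (v : Plane → ℝ) : Measurable (∇ v) :=
  (InnerProductSpace.toDual ℝ Plane).symm.continuous.measurable.comp (measurable_fderiv ℝ v)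

/-- Differentiability may fail on the boundaries of the fine triangles, so linearity of the gradient
is available only almost everywhere; boundedness of the gradients makes the integrals additive. -/
theorem IsCoefficient.isPSDOn_energy (hκ : G.IsCoefficient κ) (i : Fin N) :
    IsPSDOn (G.Vh i) (G.energy κ i) := by
  have hint : ∀ u ∈ G.Vh i, ∀ v ∈ G.Vh i,
      IntegrableOn (fun x => κ x * inner ℝ (∇ u x) (∇ v x)) (G.K i) := by
    intro u hu v hv
    obtain ⟨C, hC⟩ := ae_norm_gradient_le_Vh hu
    obtain ⟨D, hD⟩ := ae_norm_gradient_le_Vh hv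
    refine hκ.integrableOn_mul i
      ((measurable_gradient u).inner (measurable_gradient v)).aestronglyMeasurable ⟨C * D, ?_⟩
    filter_upwards [hC, hD] with x h1 h2
    exact (abs_real_inner_le_norm _ _).trans
      (mul_le_mul h1 h2 (norm_nonneg _) ((norm_nonneg _).trans h1))
  refine ⟨fun u hu v hv w hw => ?_, fun c u hu v _ => ?_, fun u _ v _ => ?_, fun u _ => ?_⟩
  · rw [energy, energy, energy, ← integral_add (hint u hu w hw) (hint v hv w hw)]
    refine integral_congr_ae ?_
    filter_upwards [ae_differentiableAt_Vh hu, ae_differentiableAt_Vh hv] with x h1 h2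
    simp only [gradient]
    rw [fderiv_add h1 h2, map_add, inner_add_left, mul_add]
  · rw [energy, energy, ← integral_const_mul]
    refine integral_congr_ae ?_
    filter_upwards [ae_differentiableAt_Vh hu] with x h1
    simp only [gradient]
    rw [fderiv_const_smul h1, map_smul, real_inner_smul_left]
    ring
  · simp only [energy, real_inner_comm]
  · refine integral_nonneg_of_ae ?_
    filter_upwards [hκ.one_le_K i] with x hx
    exact mul_nonneg (by linarith) real_inner_self_nonneg

/-! ### Discrete harmonic functions and the normal flux -/

theorem Vh0_le_Vh (i : Fin N) : G.Vh0 i ≤ G.Vh i := fun _ h => h.1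

instance finiteDimensional_Vh0 (i : Fin N) : FiniteDimensional ℝ (G.Vh0 i) :=
  Submodule.finiteDimensional_of_le (Vh0_le_Vh i)

/-- The discrete harmonic functions on a block. -/
def IsCoefficient.harmonic (hκ : G.IsCoefficient κ) (i : Fin N) : Submodule ℝ (Plane → ℝ) where
  carrier := {w | w ∈ G.Vh i ∧ ∀ z ∈ G.Vh0 i, G.energy κ i w z = 0}
  add_mem' := by
    rintro u v ⟨hu, hu'⟩ ⟨hv, hv'⟩
    refine ⟨add_mem hu hv, fun z hz => ?_⟩
    rw [(hκ.isPSDOn_energy i).add_left u hu v hv z hz.1, hu' z hz, hv' z hz, add_zero]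
  zero_mem' := by
    refine ⟨zero_mem _, fun z hz => ?_⟩
    simpa using (hκ.isPSDOn_energy i).smul_left 0 0 (zero_mem _) z hz.1
  smul_mem' := by
    rintro c u ⟨hu, hu'⟩
    refine ⟨Submodule.smul_mem _ c hu, fun z hz => ?_⟩
    rw [(hκ.isPSDOn_energy i).smul_left c u hu z hz.1, hu' z hz, mul_zero]

theorem IsCoefficient.harmonic_le_Vh (hκ : G.IsCoefficient κ) (i : Fin N) :
    hκ.harmonic i ≤ G.Vh i := fun _ h => h.1

instance IsCoefficient.finiteDimensional_harmonic (hκ : G.IsCoefficient κ) (i : Fin N) :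
    FiniteDimensional ℝ (hκ.harmonic i) :=
  Submodule.finiteDimensional_of_le (hκ.harmonic_le_Vh i)

/-- Subtracting from `v` its energy projection onto `G.Vh0 i` leaves the trace unchanged and makes
the remainder harmonic. -/
theorem IsCoefficient.exists_harmonic_eq_on_bdry (hκ : G.IsCoefficient κ) {i : Fin N}
    {v : Plane → ℝ} (hv : v ∈ G.Vh i) : ∃ w ∈ hκ.harmonic i, ∀ x ∈ G.bdry i, w x = v x := by
  obtain ⟨p, hp, hpz⟩ := (hκ.isPSDOn_energy i).exists_projection (Vh0_le_Vh i) hv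
  refine ⟨v - p, ⟨sub_mem hv hp.1, hpz⟩, fun x hx => ?_⟩
  rw [Pi.sub_apply, hp.2 x hx, sub_zero]

theorem IsCoefficient.isHarmonicExtension_of_eq (hκ : G.IsCoefficient κ) {i : Fin N}
    {g w : Plane → ℝ} (hw : w ∈ hκ.harmonic i) (h : ∀ x ∈ G.bdry i, w x = g x) :
    G.IsHarmonicExtension κ i g w := ⟨hw.1, hw.2, h⟩

theorem isPSDOn_bdry (i : Fin N) :
    IsPSDOn (G.Vh i) (fun u v => lineIntegral (G.bdry i) fun x => u x * v x) :=
  (isPSDOn_lineIntegral (G.bdry_lt_top i)).mono (G.Vh_le_boundedMeasurable i)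

/-- With zero trace, `w` is an admissible test function for its own harmonicity. This is the kernel
condition needed both for the flux and for the existence of an inverse constant. -/
theorem IsCoefficient.energy_eq_zero_of_harmonic (hκ : G.IsCoefficient κ) {i : Fin N}
    {w : Plane → ℝ} (hw : w ∈ hκ.harmonic i)
    (h : lineIntegral (G.bdry i) (fun x => w x * w x) = 0) : G.energy κ i w w = 0 :=
  hw.2 w ⟨hw.1, G.Vh_eq_zero_on_bdry hw.1 h⟩

/-- Riesz representation of `w ↦ energy(u, w)` on the harmonic functions, with respect to the
boundary form; harmonic functions of zero trace have zero energy, so the functional vanishes on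
them. -/
theorem IsCoefficient.exists_isFlux (hκ : G.IsCoefficient κ) {i : Fin N} {u : Plane → ℝ}
    (hu : u ∈ G.Vh i) : ∃ q, G.IsFlux κ i u q := by
  let ℓ : hκ.harmonic i →ₗ[ℝ] ℝ := ((hκ.isPSDOn_energy i).toBilin ⟨u, hu⟩).comp
    (Submodule.inclusion (hκ.harmonic_le_Vh i))
  obtain ⟨q, hq⟩ := ((isPSDOn_bdry i).mono (hκ.harmonic_le_Vh i)).exists_representative ℓ
    (fun w hw => (hκ.isPSDOn_energy i).eq_zero_of_self hu w.2.1
      (hκ.energy_eq_zero_of_harmonic w.2 hw))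
  refine ⟨(G.bdry i).indicator q, ⟨q, q.2.1, rfl⟩, fun g _ w hw => ?_⟩
  have h := hq ⟨w, hw.1, hw.2.1⟩
  refine (lineIntegral_congr (G.measurableSet_bdry i) fun x hx => ?_).trans h
  rw [indicator_of_mem hx, ← hw.2.2 x hx]

theorem IsCoefficient.isFlux_flux (hκ : G.IsCoefficient κ) {i : Fin N} {u : Plane → ℝ}
    (hu : u ∈ G.Vh i) : G.IsFlux κ i u (G.flux κ i u) :=
  Classical.epsilon_spec (hκ.exists_isFlux hu)

theorem VhBdry_subset_boundedMeasurable {i : Fin N} {g : Plane → ℝ} (hg : g ∈ G.VhBdry i) :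
    g ∈ boundedMeasurable := by
  obtain ⟨v, hv, rfl⟩ := hg
  exact indicator_mem_boundedMeasurable (G.measurableSet_bdry i) (G.Vh_le_boundedMeasurable i hv)

theorem IsCoefficient.flux_mem_boundedMeasurable (hκ : G.IsCoefficient κ) {i : Fin N}
    {u : Plane → ℝ} (hu : u ∈ G.Vh i) : G.flux κ i u ∈ boundedMeasurable :=
  VhBdry_subset_boundedMeasurable (hκ.isFlux_flux hu).1

/-- Testing with the difference of the two fluxes shows that its boundary norm is zero. Uniqueness
makes the chosen `flux` linear in `u`. -/
theorem IsCoefficient.isFlux_unique (hκ : G.IsCoefficient κ) {i : Fin N} {u q q' : Plane → ℝ}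
    (hq : G.IsFlux κ i u q) (hq' : G.IsFlux κ i u q') : q = q' := by
  have hqb := VhBdry_subset_boundedMeasurable hq.1
  have hqb' := VhBdry_subset_boundedMeasurable hq'.1
  obtain ⟨⟨v, hv, rfl⟩, h⟩ := hq
  obtain ⟨⟨v', hv', rfl⟩, h'⟩ := hq'
  have hd := sub_mem hv hv'
  obtain ⟨w, hw, hwd⟩ := hκ.exists_harmonic_eq_on_bdry hd
  have hg : (G.bdry i).indicator (v - v') ∈ G.VhBdry i := ⟨_, hd, rfl⟩
  have hgb := VhBdry_subset_boundedMeasurable hg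
  have hext : G.IsHarmonicExtension κ i ((G.bdry i).indicator (v - v')) w :=
    hκ.isHarmonicExtension_of_eq hw fun x hx => by rw [indicator_of_mem hx, hwd x hx]
  have h1 := (h _ hg w hext).trans (h' _ hg w hext).symm
  rw [← sub_eq_zero, ← lineIntegral_sub (G.bdry_lt_top i) (mul_mem_boundedMeasurable hqb hgb)
    (mul_mem_boundedMeasurable hqb' hgb)] at h1
  have h2 : lineIntegral (G.bdry i) (fun x => (v - v') x * (v - v') x) = 0 := by
    refine (lineIntegral_congr (G.measurableSet_bdry i) fun x hx => ?_).trans h1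
    simp only [indicator_of_mem hx, Pi.sub_apply]
    ring
  have h3 := G.Vh_eq_zero_on_bdry hd h2
  refine indicator_congr fun x hx => ?_
  have := h3 x hx
  rwa [Pi.sub_apply, sub_eq_zero] at this

theorem IsCoefficient.flux_add (hκ : G.IsCoefficient κ) {i : Fin N} {u v : Plane → ℝ}
    (hu : u ∈ G.Vh i) (hv : v ∈ G.Vh i) :
    G.flux κ i (u + v) = G.flux κ i u + G.flux κ i v := by
  refine hκ.isFlux_unique (hκ.isFlux_flux (add_mem hu hv)) ?_
  have hu' := hκ.isFlux_flux hu
  have hv' := hκ.isFlux_flux hv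
  have hub := VhBdry_subset_boundedMeasurable hu'.1
  have hvb := VhBdry_subset_boundedMeasurable hv'.1
  refine ⟨?_, fun g hg w hw => ?_⟩
  · obtain ⟨p, hp, hp'⟩ := hu'.1
    obtain ⟨q, hq, hq'⟩ := hv'.1
    exact ⟨p + q, add_mem hp hq, by rw [hp', hq', indicator_add']⟩
  · have hgb := VhBdry_subset_boundedMeasurable hg
    rw [(hκ.isPSDOn_energy i).add_left u hu v hv w hw.1, ← hu'.2 g hg w hw, ← hv'.2 g hg w hw,
      ← lineIntegral_add (G.bdry_lt_top i) (mul_mem_boundedMeasurable hub hgb)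
        (mul_mem_boundedMeasurable hvb hgb)]
    simp only [Pi.add_apply, add_mul]

theorem IsCoefficient.flux_smul (hκ : G.IsCoefficient κ) {i : Fin N} (c : ℝ) {u : Plane → ℝ}
    (hu : u ∈ G.Vh i) : G.flux κ i (c • u) = c • G.flux κ i u := by
  refine hκ.isFlux_unique (hκ.isFlux_flux (Submodule.smul_mem _ c hu)) ?_
  have hu' := hκ.isFlux_flux hu
  refine ⟨?_, fun g hg w hw => ?_⟩
  · obtain ⟨p, hp, hp'⟩ := hu'.1
    exact ⟨c • p, Submodule.smul_mem _ c hp, by rw [hp']; exact (indicator_const_smul _ c p).symm⟩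
  · rw [(hκ.isPSDOn_energy i).smul_left c u hu w hw.1, ← hu'.2 g hg w hw,
      ← lineIntegral_const_mul]
    simp only [Pi.smul_apply, smul_eq_mul, mul_assoc]

/-- The inverse inequality, with any constant larger than the optimal one. -/
theorem IsCoefficient.inverse_inequality (hκ : G.IsCoefficient κ) {C : ℝ}
    (hC : G.invConst κ < C) {i : Fin N} {g w : Plane → ℝ} (hg : g ∈ G.VhBdry i)
    (hw : G.IsHarmonicExtension κ i g w) :
    G.energy κ i w w
      ≤ G.kappaMax κ i * C ^ 2 * G.h⁻¹ * lineIntegral (G.bdry i) (fun x => g x ^ 2) := by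
  -- By finite dimension each block has some inverse constant, so the set defining `invConst` is
  -- nonempty. For an empty set, `sInf` would be the default `0` and carry no information.
  have hdom : ∀ i, ∃ D : ℝ, 0 ≤ D ∧ ∀ w ∈ hκ.harmonic i,
      G.energy κ i w w ≤ D * lineIntegral (G.bdry i) (fun x => w x * w x) := fun i =>
    ((hκ.isPSDOn_energy i).mono (hκ.harmonic_le_Vh i)).exists_dominating
      ((isPSDOn_bdry i).mono (hκ.harmonic_le_Vh i))
      fun w hw h => hκ.energy_eq_zero_of_harmonic hw h
  choose D hD0 hD using hdom
  have hsq : ∀ {i : Fin N} {g w : Plane → ℝ}, G.IsHarmonicExtension κ i g w →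
      lineIntegral (G.bdry i) (fun x => w x * w x)
        = lineIntegral (G.bdry i) (fun x => g x ^ 2) := fun hw =>
    lineIntegral_congr (G.measurableSet_bdry _) fun x hx => by rw [hw.2.2 x hx, sq]
  have hh := G.h_pos i
  have hne : {C : ℝ | 0 ≤ C ∧ ∀ i, ∀ g ∈ G.VhBdry i, ∀ w, G.IsHarmonicExtension κ i g w →
      G.energy κ i w w ≤ G.kappaMax κ i * C ^ 2 * G.h⁻¹ *
        lineIntegral (G.bdry i) (fun x => g x ^ 2)}.Nonempty := by
    have hsum : 0 ≤ ∑ j, D j := Finset.sum_nonneg fun j _ => hD0 j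
    -- This constant is admissible because `s ≤ (1 + s) ^ 2` for `s ≥ 0` and the maximum of `κ` is
    -- at least `1`.
    refine ⟨1 + G.h * ∑ j, D j, by positivity, fun j g _ w hw => ?_⟩
    refine (hD j w ⟨hw.1, hw.2.1⟩).trans ?_
    rw [hsq hw]
    refine mul_le_mul_of_nonneg_right ?_ (lineIntegral_nonneg fun x => sq_nonneg _)
    have h1 : D j ≤ ∑ j, D j := Finset.single_le_sum (fun k _ => hD0 k) (Finset.mem_univ j)
    have h2 : G.h * D j ≤ (1 + G.h * ∑ j, D j) ^ 2 := by
      have := mul_le_mul_of_nonneg_left h1 hh.le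
      nlinarith [mul_nonneg hh.le hsum]
    have h3 := hκ.one_le_kappaMax j
    calc D j = 1 * (G.h * D j) * G.h⁻¹ := by field_simp
      _ ≤ G.kappaMax κ j * (1 + G.h * ∑ j, D j) ^ 2 * G.h⁻¹ := by
        have := mul_nonneg hh.le (hD0 j)
        gcongr
  -- Since `C` exceeds the infimum strictly, attainment of the infimum is not needed.
  obtain ⟨C₀, ⟨h0, hC₀⟩, hlt⟩ := exists_lt_of_csInf_lt hne hC
  refine (hC₀ i g hg w hw).trans ?_
  refine mul_le_mul_of_nonneg_right ?_ (lineIntegral_nonneg fun x => sq_nonneg _)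
  have := (hκ.kappaMax_pos i).le
  gcongr

/-- The energy controls the normal flux. -/
theorem IsCoefficient.lineIntegral_flux_sq_le (hκ : G.IsCoefficient κ) {C : ℝ}
    (hC : G.invConst κ < C) {i : Fin N} {u : Plane → ℝ} (hu : u ∈ G.Vh i) :
    lineIntegral (G.bdry i) (fun x => G.flux κ i u x ^ 2)
      ≤ G.kappaMax κ i * C ^ 2 * G.h⁻¹ * G.energy κ i u u := by
  have hq := hκ.isFlux_flux hu
  set q := G.flux κ i u
  obtain ⟨v, hv, hqv⟩ := hq.1
  obtain ⟨w, hw, hwv⟩ := hκ.exists_harmonic_eq_on_bdry hv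
  have hext : G.IsHarmonicExtension κ i q w :=
    hκ.isHarmonicExtension_of_eq hw fun x hx => by rw [hqv, indicator_of_mem hx, hwv x hx]
  -- The flux is tested with itself: `I = energy(u, w)`, so `I² ≤ energy(u, u) energy(w, w) ≤ c
  -- energy(u, u) I`, and one factor `I` cancels if it is positive.
  have h1 := hq.2 q hq.1 w hext
  simp only [← sq] at h1
  have h2 := hκ.inverse_inequality hC hq.1 hext
  have h3 := (hκ.isPSDOn_energy i).cauchy_schwarz hu hw.1
  have hE := (hκ.isPSDOn_energy i).nonneg u hu
  set I := lineIntegral (G.bdry i) (fun x => q x ^ 2)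
  set c := G.kappaMax κ i * C ^ 2 * G.h⁻¹
  have hI : 0 ≤ I := lineIntegral_nonneg fun x => sq_nonneg _
  rw [← h1] at h3
  have h4 : I * I ≤ (c * G.energy κ i u u) * I := by
    have := mul_le_mul_of_nonneg_left h2 hE
    nlinarith
  rcases hI.eq_or_lt with h | h
  · have hc : 0 ≤ c := by
      have := (hκ.kappaMax_pos i).le
      have := (G.h_pos i).le
      positivity
    rw [← h]
    exact mul_nonneg hc hE
  · exact le_of_mul_le_mul_right h4 h

/-! ### The snapshot spaces -/

theorem IsCoefficient.Vsnap1_le_harmonic (hκ : G.IsCoefficient κ) (i : Fin N) :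
    G.Vsnap1 κ i ≤ hκ.harmonic i := by
  refine Submodule.span_le.2 ?_
  rintro ψ ⟨p, -, δ, -, -, -, hψ⟩
  exact ⟨hψ.1, hψ.2.1⟩

/-- Energy-orthogonal decomposition into the two snapshot spaces. -/
theorem IsCoefficient.exists_snapshot_decomposition (hκ : G.IsCoefficient κ) {i : Fin N}
    {v : Plane → ℝ} (hv : v ∈ G.Vh i) :
    ∃ v₁ ∈ G.Vsnap1 κ i, ∃ v₂ ∈ G.Vsnap2 i, v = v₁ + v₂ ∧
      G.energy κ i v v = G.energy κ i v₁ v₁ + G.energy κ i v₂ v₂ := by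
  classical
  have hψ : ∀ p ∈ G.bdryNodes i, ∃ ψ ∈ G.Vsnap1 κ i,
      ∀ q ∈ G.bdryNodes i, ψ q = if q = p then 1 else 0 := by
    intro p hp
    obtain ⟨d, hd, hdp⟩ := G.exists_Vh_interpolating i fun q => if q = p then 1 else 0
    obtain ⟨w, hw, hwd⟩ := hκ.exists_harmonic_eq_on_bdry hd
    have hval : ∀ q ∈ G.bdryNodes i, d q = if q = p then 1 else 0 := fun q hq =>
      hdp q (G.bdryNodes_subset_blockNodes i hq)
    have hind : ∀ q ∈ G.bdryNodes i, (G.bdry i).indicator d q = if q = p then 1 else 0 :=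
      fun q hq => by rw [indicator_of_mem (G.bdryNodes_subset_bdry i hq), hval q hq]
    refine ⟨w, Submodule.subset_span ⟨p, hp, (G.bdry i).indicator d, ⟨d, hd, rfl⟩, ?_, ?_, ?_⟩,
      fun q hq => by rw [hwd q (G.bdryNodes_subset_bdry i hq), hval q hq]⟩
    · rw [hind p hp, if_pos rfl]
    · exact fun q hq hqp => by rw [hind q hq, if_neg hqp]
    · exact hκ.isHarmonicExtension_of_eq hw fun x hx => by rw [hwd x hx, indicator_of_mem hx]
  choose! ψ hψV hψval using hψ
  set S := (G.finite_bdryNodes i).toFinset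
  have hS : ∀ p, p ∈ S ↔ p ∈ G.bdryNodes i := fun p => Set.Finite.mem_toFinset _
  -- The harmonic part is interpolated from the boundary nodal values of `v`. These determine the
  -- trace, so the rest lies in `G.Vh0 i`, to which harmonic functions are energy-orthogonal.
  have hv₁ : ∑ p ∈ S, v p • ψ p ∈ G.Vsnap1 κ i :=
    Submodule.sum_mem _ fun p hp => Submodule.smul_mem _ _ (hψV p ((hS p).1 hp))
  have hv₁h := hκ.Vsnap1_le_harmonic i hv₁
  set v₁ := ∑ p ∈ S, v p • ψ p with hv₁def
  have htrace : ∀ x ∈ G.bdry i, v₁ x = v x := by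
    refine G.Vh_eq_on_bdry_of_nodes hv₁h.1 hv fun q hq => ?_
    rw [hv₁def, Finset.sum_apply, Finset.sum_eq_single q]
    · rw [Pi.smul_apply, hψval q hq q hq, if_pos rfl, smul_eq_mul, mul_one]
    · intro p hp hpq
      rw [Pi.smul_apply, hψval p ((hS p).1 hp) q hq, if_neg hpq.symm, smul_zero]
    · exact fun h => absurd ((hS q).2 hq) h
  have hv₂ : v - v₁ ∈ G.Vh0 i :=
    ⟨sub_mem hv hv₁h.1, fun x hx => by rw [Pi.sub_apply, htrace x hx, sub_self]⟩
  refine ⟨v₁, hv₁, v - v₁, hv₂, (add_sub_cancel v₁ v).symm, ?_⟩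
  conv_lhs => rw [← add_sub_cancel v₁ v]
  exact (hκ.isPSDOn_energy i).add_self hv₁h.1 hv₂.1 (hv₁h.2 _ hv₂)

/-! ### The interior penalty form -/

theorem mem_VDG {u : Fin N → Plane → ℝ} : u ∈ G.VDG ↔ ∀ i, u i ∈ G.Vh i := by
  simp [VDG, Submodule.mem_pi]

theorem single_mem_VDG {i : Fin N} {v : Plane → ℝ} (hv : v ∈ G.Vh i) :
    (Pi.single i v : Fin N → Plane → ℝ) ∈ G.VDG := by
  refine mem_VDG.2 fun j => ?_
  by_cases h : j = i
  · subst h; rwa [Pi.single_eq_same]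
  · rw [Pi.single_eq_of_ne h]; exact zero_mem _

theorem interEdge_lt_top (i j : Fin N) : μH[1] (G.interEdge i j) < ⊤ :=
  G.hausdorffMeasure_carrier_lt_top (G.interEdges_subset i j)

theorem outerEdge_lt_top (i : Fin N) : μH[1] (G.outerEdge i) < ⊤ :=
  G.hausdorffMeasure_carrier_lt_top (G.outerEdges_subset i)

/-- The coarse edges of a block overlap only in null sets. -/
theorem sum_lineIntegral_coarse_edges_le (i : Fin N) {w : Plane → ℝ}
    (hw : w ∈ boundedMeasurable) (hw0 : ∀ x, 0 ≤ w x) :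
    ∑ j ∈ {i}ᶜ, lineIntegral (G.interEdge i j) w + lineIntegral (G.outerEdge i) w
      ≤ lineIntegral (G.bdry i) w := by
  -- The index `none` stands for the part on the outer boundary, `some j` for the interface with
  -- block `j`. The value `∅` at `j = i` is needed because `interEdges i i` contains all edges of
  -- the block.
  let F : Option (Fin N) → Set (Finset Plane) := fun o =>
    o.elim (G.outerEdges i) fun j => if j = i then ∅ else G.interEdges i j
  have hFsub : ∀ o, F o ⊆ G.bdryEdges i := by
    rintro (_ | j)
    · exact G.outerEdges_subset_bdryEdges i
    · by_cases h : j = i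
      · simp [F, h]
      · simpa [F, h] using G.interEdges_subset_bdryEdges (Ne.symm h)
  have hFe : ∀ o, F o ⊆ G.edges := fun o => (hFsub o).trans (G.bdryEdges_subset i)
  have hdisj : ∀ o o', o ≠ o' → Disjoint (F o) (F o') := by
    rintro (_ | j) (_ | k) hne
    · exact absurd rfl hne
    · by_cases h : k = i
      · simp [F, h]
      · simpa [F, h] using G.disjoint_outerEdges_interEdges (Ne.symm h)
    · by_cases h : j = i
      · simp [F, h]
      · simpa [F, h] using (G.disjoint_outerEdges_interEdges (Ne.symm h)).symm
    · by_cases h : j = i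
      · simp [F, h]
      · by_cases h' : k = i
        · simp [F, h']
        · simpa [F, h, h'] using G.disjoint_interEdges (Ne.symm h) (Ne.symm h')
            (fun h => hne (by rw [h]))
  have hsub : ⋃ o, carrier (F o) ⊆ G.bdry i := iUnion_subset fun o => carrier_mono (hFsub o)
  have hint := integrableOn_of_boundedMeasurable (G.bdry_lt_top i) hw
  have hsum := integral_iUnion_ae (μ := μH[1]) (f := w)
    (fun o => (G.measurableSet_carrier (hFe o)).nullMeasurableSet)
    (fun o o' h => G.aedisjoint_carrier (hFe o) (hFe o') (hdisj o o' h)) (hint.mono_set hsub)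
  have hle : ∫ x in ⋃ o, carrier (F o), w x ∂(μH[1]) ≤ lineIntegral (G.bdry i) w :=
    setIntegral_mono_set hint (Filter.Eventually.of_forall hw0)
      (Filter.Eventually.of_forall hsub)
  rw [hsum, tsum_fintype, Fintype.sum_option, add_comm] at hle
  refine le_trans (le_of_eq ?_) hle
  congr 1
  rw [← Finset.sum_subset (Finset.subset_univ ({i}ᶜ : Finset (Fin N)))]
  · refine Finset.sum_congr rfl fun j hj => ?_
    have h : j ≠ i := by simpa using hj
    simp [F, h, lineIntegral, interEdge]
  · intro j _ hj
    have h : j = i := by simpa using hj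
    simp [F, h, carrier]

section VDG

variable {u u' v : Fin N → Plane → ℝ}

theorem jump_mem_boundedMeasurable (hu : u ∈ G.VDG) (i j : Fin N) :
    jump u i j ∈ boundedMeasurable :=
  sub_mem (G.Vh_le_boundedMeasurable i (mem_VDG.1 hu i))
    (G.Vh_le_boundedMeasurable j (mem_VDG.1 hu j))

theorem IsCoefficient.avgFlux_mem_boundedMeasurable (hκ : G.IsCoefficient κ) (hu : u ∈ G.VDG)
    (i j : Fin N) : G.avgFlux κ u i j ∈ boundedMeasurable := by
  have h := boundedMeasurable.smul_mem (2⁻¹ : ℝ)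
    (sub_mem (hκ.flux_mem_boundedMeasurable (mem_VDG.1 hu i))
      (hκ.flux_mem_boundedMeasurable (mem_VDG.1 hu j)))
  convert h using 1
  funext x
  simp only [avgFlux, Pi.smul_apply, Pi.sub_apply, smul_eq_mul]
  ring

theorem jump_add (u u' : Fin N → Plane → ℝ) (i j : Fin N) (x : Plane) :
    jump (u + u') i j x = jump u i j x + jump u' i j x := by
  simp only [jump, Pi.add_apply]
  ring

theorem jump_smul (c : ℝ) (u : Fin N → Plane → ℝ) (i j : Fin N) (x : Plane) :
    jump (c • u) i j x = c * jump u i j x := by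
  simp only [jump, Pi.smul_apply, smul_eq_mul]
  ring

theorem IsCoefficient.avgFlux_add (hκ : G.IsCoefficient κ) (hu : u ∈ G.VDG) (hu' : u' ∈ G.VDG)
    (i j : Fin N) (x : Plane) :
    G.avgFlux κ (u + u') i j x = G.avgFlux κ u i j x + G.avgFlux κ u' i j x := by
  simp only [avgFlux, Pi.add_apply, hκ.flux_add (mem_VDG.1 hu _) (mem_VDG.1 hu' _)]
  ring

theorem IsCoefficient.avgFlux_smul (hκ : G.IsCoefficient κ) (c : ℝ) (hu : u ∈ G.VDG)
    (i j : Fin N) (x : Plane) : G.avgFlux κ (c • u) i j x = c * G.avgFlux κ u i j x := by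
  simp only [avgFlux, Pi.smul_apply, hκ.flux_smul c (mem_VDG.1 hu _), smul_eq_mul]
  ring

theorem IsCoefficient.aDG_add_left (hκ : G.IsCoefficient κ) (γ : ℝ) (hu : u ∈ G.VDG)
    (hu' : u' ∈ G.VDG) (hv : v ∈ G.VDG) :
    G.aDG κ γ (u + u') v = G.aDG κ γ u v + G.aDG κ γ u' v := by
  have hb : ∀ {w : Fin N → Plane → ℝ}, w ∈ G.VDG → ∀ i, w i ∈ boundedMeasurable := fun hw i =>
    G.Vh_le_boundedMeasurable i (mem_VDG.1 hw i)
  have hf : ∀ {w : Fin N → Plane → ℝ}, w ∈ G.VDG → ∀ i, G.flux κ i (w i) ∈ boundedMeasurable :=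
    fun hw i => hκ.flux_mem_boundedMeasurable (mem_VDG.1 hw i)
  have h1 : ∀ i, G.energy κ i ((u + u') i) (v i)
      = G.energy κ i (u i) (v i) + G.energy κ i (u' i) (v i) := fun i =>
    (hκ.isPSDOn_energy i).add_left _ (mem_VDG.1 hu i) _ (mem_VDG.1 hu' i) _ (mem_VDG.1 hv i)
  have m2 : ∀ {w : Fin N → Plane → ℝ}, w ∈ G.VDG → ∀ i j, (fun x =>
      G.avgFlux κ w i j x * jump v i j x + G.avgFlux κ v i j x * jump w i j x)
        ∈ boundedMeasurable := fun hw i j =>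
    add_mem (mul_mem_boundedMeasurable (hκ.avgFlux_mem_boundedMeasurable hw i j)
        (jump_mem_boundedMeasurable hv i j))
      (mul_mem_boundedMeasurable (hκ.avgFlux_mem_boundedMeasurable hv i j)
        (jump_mem_boundedMeasurable hw i j))
  have h2 : ∀ i j, lineIntegral (G.interEdge i j) (fun x =>
        G.avgFlux κ (u + u') i j x * jump v i j x + G.avgFlux κ v i j x * jump (u + u') i j x)
      = lineIntegral (G.interEdge i j) (fun x =>
          G.avgFlux κ u i j x * jump v i j x + G.avgFlux κ v i j x * jump u i j x)
        + lineIntegral (G.interEdge i j) (fun x =>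
          G.avgFlux κ u' i j x * jump v i j x + G.avgFlux κ v i j x * jump u' i j x) := by
    intro i j
    rw [← lineIntegral_add (interEdge_lt_top i j) (m2 hu i j) (m2 hu' i j)]
    congr 1
    funext x
    rw [hκ.avgFlux_add hu hu', jump_add]
    ring
  have m3 : ∀ {w : Fin N → Plane → ℝ}, w ∈ G.VDG → ∀ i, (fun x =>
      G.flux κ i (w i) x * v i x + G.flux κ i (v i) x * w i x) ∈ boundedMeasurable := fun hw i =>
    add_mem (mul_mem_boundedMeasurable (hf hw i) (hb hv i))
      (mul_mem_boundedMeasurable (hf hv i) (hb hw i))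
  have h3 : ∀ i, lineIntegral (G.outerEdge i) (fun x =>
        G.flux κ i ((u + u') i) x * v i x + G.flux κ i (v i) x * (u + u') i x)
      = lineIntegral (G.outerEdge i) (fun x =>
          G.flux κ i (u i) x * v i x + G.flux κ i (v i) x * u i x)
        + lineIntegral (G.outerEdge i) (fun x =>
          G.flux κ i (u' i) x * v i x + G.flux κ i (v i) x * u' i x) := by
    intro i
    rw [← lineIntegral_add (outerEdge_lt_top i) (m3 hu i) (m3 hu' i)]
    congr 1
    funext x
    rw [Pi.add_apply, hκ.flux_add (mem_VDG.1 hu i) (mem_VDG.1 hu' i)]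
    simp only [Pi.add_apply]
    ring
  have m4 : ∀ {w : Fin N → Plane → ℝ}, w ∈ G.VDG → ∀ i j, (fun x =>
      G.kappaBar κ i j * jump w i j x * jump v i j x) ∈ boundedMeasurable := fun hw i j =>
    mul_mem_boundedMeasurable (const_mul_mem_boundedMeasurable _ (jump_mem_boundedMeasurable hw i j))
      (jump_mem_boundedMeasurable hv i j)
  have h4 : ∀ i j, lineIntegral (G.interEdge i j) (fun x =>
        G.kappaBar κ i j * jump (u + u') i j x * jump v i j x)
      = lineIntegral (G.interEdge i j) (fun x => G.kappaBar κ i j * jump u i j x * jump v i j x)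
        + lineIntegral (G.interEdge i j) (fun x =>
          G.kappaBar κ i j * jump u' i j x * jump v i j x) := by
    intro i j
    rw [← lineIntegral_add (interEdge_lt_top i j) (m4 hu i j) (m4 hu' i j)]
    congr 1
    funext x
    rw [jump_add]
    ring
  have m5 : ∀ {w : Fin N → Plane → ℝ}, w ∈ G.VDG → ∀ i, (fun x =>
      G.kappaMax κ i * w i x * v i x) ∈ boundedMeasurable := fun hw i =>
    mul_mem_boundedMeasurable (const_mul_mem_boundedMeasurable _ (hb hw i)) (hb hv i)
  have h5 : ∀ i, lineIntegral (G.outerEdge i) (fun x => G.kappaMax κ i * (u + u') i x * v i x)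
      = lineIntegral (G.outerEdge i) (fun x => G.kappaMax κ i * u i x * v i x)
        + lineIntegral (G.outerEdge i) (fun x => G.kappaMax κ i * u' i x * v i x) := by
    intro i
    rw [← lineIntegral_add (outerEdge_lt_top i) (m5 hu i) (m5 hu' i)]
    congr 1
    funext x
    simp only [Pi.add_apply]
    ring
  simp only [aDG, h1, h2, h3, h4, h5, mul_add, Finset.sum_add_distrib]
  ring

theorem IsCoefficient.aDG_smul_left (hκ : G.IsCoefficient κ) (γ c : ℝ) (hu : u ∈ G.VDG)
    (hv : v ∈ G.VDG) : G.aDG κ γ (c • u) v = c * G.aDG κ γ u v := by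
  have h1 : ∀ i, G.energy κ i ((c • u) i) (v i) = c * G.energy κ i (u i) (v i) := fun i =>
    (hκ.isPSDOn_energy i).smul_left c _ (mem_VDG.1 hu i) _ (mem_VDG.1 hv i)
  have h2 : ∀ i j, lineIntegral (G.interEdge i j) (fun x =>
        G.avgFlux κ (c • u) i j x * jump v i j x + G.avgFlux κ v i j x * jump (c • u) i j x)
      = c * lineIntegral (G.interEdge i j) (fun x =>
          G.avgFlux κ u i j x * jump v i j x + G.avgFlux κ v i j x * jump u i j x) := by
    intro i j
    rw [← lineIntegral_const_mul]
    congr 1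
    funext x
    rw [hκ.avgFlux_smul c hu, jump_smul]
    ring
  have h3 : ∀ i, lineIntegral (G.outerEdge i) (fun x =>
        G.flux κ i ((c • u) i) x * v i x + G.flux κ i (v i) x * (c • u) i x)
      = c * lineIntegral (G.outerEdge i) (fun x =>
          G.flux κ i (u i) x * v i x + G.flux κ i (v i) x * u i x) := by
    intro i
    rw [← lineIntegral_const_mul]
    congr 1
    funext x
    rw [Pi.smul_apply, hκ.flux_smul c (mem_VDG.1 hu i)]
    simp only [Pi.smul_apply, smul_eq_mul]
    ring
  have h4 : ∀ i j, lineIntegral (G.interEdge i j) (fun x =>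
        G.kappaBar κ i j * jump (c • u) i j x * jump v i j x)
      = c * lineIntegral (G.interEdge i j) (fun x =>
          G.kappaBar κ i j * jump u i j x * jump v i j x) := by
    intro i j
    rw [← lineIntegral_const_mul]
    congr 1
    funext x
    rw [jump_smul]
    ring
  have h5 : ∀ i, lineIntegral (G.outerEdge i) (fun x => G.kappaMax κ i * (c • u) i x * v i x)
      = c * lineIntegral (G.outerEdge i) (fun x => G.kappaMax κ i * u i x * v i x) := by
    intro i
    rw [← lineIntegral_const_mul]
    congr 1
    funext x
    simp only [Pi.smul_apply, smul_eq_mul]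
    ring
  simp only [aDG, h1, h2, h3, h4, h5, mul_left_comm _ c, ← Finset.mul_sum]
  ring

theorem IsCoefficient.aDG_symm (hκ : G.IsCoefficient κ) (γ : ℝ) (hu : u ∈ G.VDG)
    (hv : v ∈ G.VDG) : G.aDG κ γ u v = G.aDG κ γ v u := by
  have h1 : ∀ i, G.energy κ i (u i) (v i) = G.energy κ i (v i) (u i) := fun i =>
    (hκ.isPSDOn_energy i).symm _ (mem_VDG.1 hu i) _ (mem_VDG.1 hv i)
  have h2 : ∀ i j, lineIntegral (G.interEdge i j) (fun x =>
        G.avgFlux κ u i j x * jump v i j x + G.avgFlux κ v i j x * jump u i j x)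
      = lineIntegral (G.interEdge i j) (fun x =>
        G.avgFlux κ v i j x * jump u i j x + G.avgFlux κ u i j x * jump v i j x) :=
    fun i j => congr_arg _ (funext fun x => add_comm _ _)
  have h3 : ∀ i, lineIntegral (G.outerEdge i) (fun x =>
        G.flux κ i (u i) x * v i x + G.flux κ i (v i) x * u i x)
      = lineIntegral (G.outerEdge i) (fun x =>
        G.flux κ i (v i) x * u i x + G.flux κ i (u i) x * v i x) :=
    fun i => congr_arg _ (funext fun x => add_comm _ _)
  have h4 : ∀ i j, lineIntegral (G.interEdge i j) (fun x =>
        G.kappaBar κ i j * jump u i j x * jump v i j x)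
      = lineIntegral (G.interEdge i j) (fun x =>
        G.kappaBar κ i j * jump v i j x * jump u i j x) :=
    fun i j => congr_arg _ (funext fun x => mul_right_comm _ _ _)
  have h5 : ∀ i, lineIntegral (G.outerEdge i) (fun x => G.kappaMax κ i * u i x * v i x)
      = lineIntegral (G.outerEdge i) (fun x => G.kappaMax κ i * v i x * u i x) :=
    fun i => congr_arg _ (funext fun x => mul_right_comm _ _ _)
  simp only [aDG, h1, h2, h3, h4, h5]

theorem two_mul_le_weighted {t : ℝ} (ht : 0 < t) (x y : ℝ) :
    2 * (x * y) ≤ t⁻¹ * x ^ 2 + t * y ^ 2 := by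
  have h : t⁻¹ * x ^ 2 + t * y ^ 2 - 2 * (x * y) = t⁻¹ * (x - t * y) ^ 2 := by
    field_simp
    ring
  have := mul_nonneg (inv_nonneg.2 ht.le) (sq_nonneg (x - t * y))
  linarith

/-- Coercivity of the interior penalty form. -/
theorem IsCoefficient.aDG_coercive (hκ : G.IsCoefficient κ) {C γ : ℝ} (hC : G.invConst κ < C)
    (hγ : C ^ 2 < γ) (hv : v ∈ G.VDG) :
    (1 - C ^ 2 / γ) * ∑ i, G.energy κ i (v i) (v i) ≤ G.aDG κ γ v v := by
  have hγ0 : 0 < γ := (sq_nonneg C).trans_lt hγ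
  set q : Fin N → Plane → ℝ := fun i => G.flux κ i (v i) with hq
  have hqb : ∀ i, q i ∈ boundedMeasurable := fun i =>
    hκ.flux_mem_boundedMeasurable (mem_VDG.1 hv i)
  have hvb : ∀ i, v i ∈ boundedMeasurable := fun i =>
    G.Vh_le_boundedMeasurable i (mem_VDG.1 hv i)
  -- With these Young weights the mean of `t i` and `t j` is `γ / h` times `kappaBar κ i j`, so the
  -- penalty absorbs the jump terms exactly.
  set t : Fin N → ℝ := fun i => γ / G.h * G.kappaMax κ i with ht
  have ht0 : ∀ i, 0 < t i := fun i => mul_pos (div_pos hγ0 (G.h_pos i)) (hκ.kappaMax_pos i)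
  let I : Fin N → Set Plane → ℝ := fun i S => (t i)⁻¹ * lineIntegral S fun x => q i x ^ 2
  have hinter : ∀ i j, lineIntegral (G.interEdge i j) (fun x =>
        G.avgFlux κ v i j x * jump v i j x + G.avgFlux κ v i j x * jump v i j x)
      ≤ (I i (G.interEdge i j) + I j (G.interEdge j i)) +
        γ / G.h * lineIntegral (G.interEdge i j)
          (fun x => G.kappaBar κ i j * jump v i j x * jump v i j x) := by
    intro i j
    have hS := interEdge_lt_top (G := G) i j
    have hcomm : G.interEdge j i = G.interEdge i j := by
      rw [interEdge, interEdge, G.interEdges_comm]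
    have hA := hκ.avgFlux_mem_boundedMeasurable hv i j
    have hJ := jump_mem_boundedMeasurable hv i j
    have b1 := const_mul_mem_boundedMeasurable (t i)⁻¹ (sq_mem_boundedMeasurable (hqb i))
    have b2 := const_mul_mem_boundedMeasurable (t j)⁻¹ (sq_mem_boundedMeasurable (hqb j))
    have b12 : (fun x => (t i)⁻¹ * q i x ^ 2 + (t j)⁻¹ * q j x ^ 2) ∈ boundedMeasurable :=
      add_mem b1 b2
    have b3 := const_mul_mem_boundedMeasurable (γ / G.h) (mul_mem_boundedMeasurable
      (const_mul_mem_boundedMeasurable (G.kappaBar κ i j) hJ) hJ)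
    simp only [I]
    rw [hcomm, ← lineIntegral_const_mul, ← lineIntegral_const_mul, ← lineIntegral_const_mul,
      ← lineIntegral_add hS b1 b2, ← lineIntegral_add hS b12 b3]
    refine lineIntegral_mono hS (add_mem (mul_mem_boundedMeasurable hA hJ)
      (mul_mem_boundedMeasurable hA hJ)) (add_mem b12 b3) fun x => ?_
    have y1 := two_mul_le_weighted (ht0 i) (q i x) (jump v i j x)
    have y2 := two_mul_le_weighted (ht0 j) (-q j x) (jump v i j x)
    -- The average carries a factor `1 / 2`, so only half of each flux term is needed; `p1` and `p2`
    -- give away the other half, to match the weight on outer edges.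
    have p1 := mul_nonneg (inv_nonneg.2 (ht0 i).le) (sq_nonneg (q i x))
    have p2 := mul_nonneg (inv_nonneg.2 (ht0 j).le) (sq_nonneg (q j x))
    have e1 : G.avgFlux κ v i j x = (q i x + -q j x) / 2 := rfl
    have e2 : γ / G.h * (G.kappaBar κ i j * jump v i j x * jump v i j x)
        = (t i + t j) / 2 * jump v i j x ^ 2 := by
      simp only [ht, kappaBar]
      ring
    rw [neg_sq] at y2
    rw [e1, e2]
    linarith
  have houter : ∀ i, lineIntegral (G.outerEdge i) (fun x =>
        q i x * v i x + q i x * v i x)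
      ≤ I i (G.outerEdge i) + γ / G.h * lineIntegral (G.outerEdge i)
          (fun x => G.kappaMax κ i * v i x * v i x) := by
    intro i
    have hS := outerEdge_lt_top (G := G) i
    have b1 := const_mul_mem_boundedMeasurable (t i)⁻¹ (sq_mem_boundedMeasurable (hqb i))
    have b2 := mul_mem_boundedMeasurable (hqb i) (hvb i)
    have b3 := const_mul_mem_boundedMeasurable (γ / G.h) (mul_mem_boundedMeasurable
      (const_mul_mem_boundedMeasurable (G.kappaMax κ i) (hvb i)) (hvb i))
    simp only [I]
    rw [← lineIntegral_const_mul, ← lineIntegral_const_mul, ← lineIntegral_add hS b1 b3]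
    refine lineIntegral_mono hS (add_mem b2 b2) (add_mem b1 b3) fun x => ?_
    have y1 := two_mul_le_weighted (ht0 i) (q i x) (v i x)
    have e2 : γ / G.h * (G.kappaMax κ i * v i x * v i x) = t i * v i x ^ 2 := by
      simp only [ht]
      ring
    rw [e2]
    linarith
  -- The factor `C² / γ` is `κ_K C² h⁻¹` from the flux bound divided by the weight `t i`; maximum of
  -- `κ` and mesh size cancel.
  have hflux : ∀ i, ∑ j ∈ {i}ᶜ, I i (G.interEdge i j) + I i (G.outerEdge i)
      ≤ C ^ 2 / γ * G.energy κ i (v i) (v i) := by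
    intro i
    have h1 := sum_lineIntegral_coarse_edges_le (G := G) i (sq_mem_boundedMeasurable (hqb i))
      fun x => sq_nonneg _
    have h2 := hκ.lineIntegral_flux_sq_le hC (mem_VDG.1 hv i)
    have h3 := mul_le_mul_of_nonneg_left (h1.trans h2) (inv_nonneg.2 (ht0 i).le)
    rw [mul_add, Finset.mul_sum] at h3
    refine h3.trans (le_of_eq ?_)
    have hh := (G.h_pos i).ne'
    have hk := (hκ.kappaMax_pos i).ne'
    have hg := hγ0.ne'
    simp only [ht]
    field_simp
  have hsum1 := Finset.sum_le_sum fun i (_ : i ∈ Finset.univ) =>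
    Finset.sum_le_sum fun j (_ : j ∈ Finset.Ioi i) => hinter i j
  have hsum2 := Finset.sum_le_sum fun i (_ : i ∈ Finset.univ) => houter i
  have hsum3 := Finset.sum_le_sum fun i (_ : i ∈ Finset.univ) => hflux i
  -- Each pair `i < j` carries a flux term for both its blocks; regrouped by blocks, these are the
  -- sums over `j ≠ i` in `hflux`.
  have hpair := Finset.sum_sum_Ioi_add_eq_sum_sum_off_diag fun i j : Fin N =>
    I j (G.interEdge j i)
  simp only [Finset.sum_add_distrib, ← Finset.mul_sum] at hsum1 hsum2 hsum3 hpair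
  simp only [aDG, ← Finset.mul_sum]
  rw [← hpair] at hsum3
  linarith

end VDG

theorem IsCoefficient.isPSDOn_aDG (hκ : G.IsCoefficient κ) {C γ : ℝ} (hC : G.invConst κ < C)
    (hγ : C ^ 2 < γ) : IsPSDOn G.VDG (G.aDG κ γ) where
  add_left u hu v hv w hw := hκ.aDG_add_left γ hu hv hw
  smul_left c u hu v hv := hκ.aDG_smul_left γ c hu hv
  symm u hu v hv := hκ.aDG_symm γ hu hv
  nonneg u hu := by
    refine le_trans (mul_nonneg ?_ ?_) (hκ.aDG_coercive hC hγ hu)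
    · have hγ0 : 0 < γ := (sq_nonneg C).trans_lt hγ
      rw [sub_nonneg, div_le_one hγ0]
      exact hγ.le
    · exact Finset.sum_nonneg fun i _ => (hκ.isPSDOn_energy i).nonneg _ (mem_VDG.1 hu i)

/-! ### Galerkin orthogonality of the residual. -/

theorem sum_source_single (f : Plane → ℝ) (i : Fin N) (v : Plane → ℝ) :
    ∑ j, G.source f j ((Pi.single i v : Fin N → Plane → ℝ) j) = G.source f i v := by
  rw [Finset.sum_eq_single i]
  · rw [Pi.single_eq_same]
  · intro j _ hj
    rw [Pi.single_eq_of_ne hj]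
    simp [source]
  · exact fun h => absurd (Finset.mem_univ i) h

theorem IsGalerkinSolution.residual_eq_zero {γ : ℝ} {f : Plane → ℝ}
    {V : Submodule ℝ (Fin N → Plane → ℝ)} {u : Fin N → Plane → ℝ}
    (hu : G.IsGalerkinSolution κ γ f V u) {i : Fin N} {v : Plane → ℝ}
    (hv : (Pi.single i v : Fin N → Plane → ℝ) ∈ V) : G.residual κ γ f u i v = 0 := by
  rw [residual, hu.2 _ hv, sum_source_single, sub_self]

theorem single_mem_Voff {M₁ M₂ : Fin N → ℕ} {φ : ∀ i, Fin (M₁ i) → Plane → ℝ}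
    {ξ : ∀ i, Fin (M₂ i) → Plane → ℝ} {l₁ l₂ : Fin N → ℕ} {i : Fin N} {v : Plane → ℝ}
    (hv : v ∈ firstSpan (φ i) (l₁ i) ⊔ firstSpan (ξ i) (l₂ i)) :
    (Pi.single i v : Fin N → Plane → ℝ) ∈ Voff φ ξ l₁ l₂ := by
  refine Submodule.mem_pi.2 fun j _ => ?_
  by_cases h : j = i
  · subst h; rwa [Pi.single_eq_same]
  · rw [Pi.single_eq_of_ne h]; exact zero_mem _

end TwoGrid

/-- From `X a = (c⁻¹ X) (c a)` and `4 x y ≤ (x + y) ^ 2`. The weight `c` is meant to be the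
coercivity constant. -/
theorem two_mul_le_of_sq_le {c R X a : ℝ} (hc : 0 < c) (hX : 0 ≤ X) (ha : 0 ≤ a)
    (h : R ^ 2 ≤ X * a) : 2 * R ≤ c⁻¹ * X + c * a := by
  have h1 : (2 * R) ^ 2 ≤ (c⁻¹ * X + c * a) ^ 2 := by
    have h2 : X * a = (c⁻¹ * X) * (c * a) := by field_simp
    rw [h2] at h
    nlinarith [sq_nonneg (c⁻¹ * X - c * a)]
  exact (le_abs_self _).trans (abs_le_of_sq_le_sq h1 (by positivity))

end GMsDGM
end

/-! ### The a posteriori error estimate. -/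

theorem mainTheorem2 (Cinv γ : ℝ) (hCinv : 0 ≤ Cinv) (hγ : Cinv ^ 2 < γ) :
    ∃ Cerr : ℝ, 0 < Cerr ∧
      ∀ (N : ℕ) (G : GMsDGM.TwoGrid N) (κ f : GMsDGM.Plane → ℝ),
        AEStronglyMeasurable κ (volume.restrict G.closedDomain) →
        (∀ᵐ x ∂(volume.restrict G.closedDomain), 1 ≤ κ x) →
        (∃ B : ℝ, ∀ᵐ x ∂(volume.restrict G.closedDomain), κ x ≤ B) →
        MemLp f 2 (volume.restrict G.closedDomain) →
        G.invConst κ ≤ Cinv →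
        ∀ (M₁ M₂ : Fin N → ℕ)
          (φ : ∀ i, Fin (M₁ i) → GMsDGM.Plane → ℝ) (lam₁ : ∀ i, Fin (M₁ i) → ℝ)
          (ξ : ∀ i, Fin (M₂ i) → GMsDGM.Plane → ℝ) (lam₂ : ∀ i, Fin (M₂ i) → ℝ),
          (∀ i, GMsDGM.IsEigenbasis (G.Vsnap1 κ i) (G.energy κ i) (G.form1 κ i) (φ i) (lam₁ i)) →
          (∀ i, GMsDGM.IsEigenbasis (G.Vsnap2 i) (G.energy κ i) (G.form2 κ i) (ξ i) (lam₂ i)) →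
          ∀ (l₁ l₂ : Fin N → ℕ) (uh uH : Fin N → GMsDGM.Plane → ℝ),
            G.IsGalerkinSolution κ γ f G.VDG uh →
            G.IsGalerkinSolution κ γ f (GMsDGM.Voff φ ξ l₁ l₂) uH →
            ENNReal.ofReal (G.aDG κ γ (uh - uH) (uh - uH)) ≤
              ENNReal.ofReal Cerr * ∑ i,
                (GMsDGM.dualNorm (G.Vsnap1 κ i) (G.form1 κ i) (G.residual κ γ f uH i) ^ 2 *
                    (GMsDGM.nextEigenvalue (lam₁ i) (l₁ i))⁻¹ +
                  GMsDGM.dualNorm (G.Vsnap2 i) (G.form2 κ i) (G.residual κ γ f uH i) ^ 2 *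
                    (GMsDGM.nextEigenvalue (lam₂ i) (l₂ i))⁻¹) := by
  have hγ0 : 0 < γ := (sq_nonneg Cinv).trans_lt hγ
  -- The inverse inequality is available only above the infimum, so `C` is taken strictly between
  -- `Cinv` and `√γ`. It depends on `Cinv` and `γ` alone, and so does the final constant.
  obtain ⟨C, hCC, hCγ⟩ : ∃ C : ℝ, Cinv < C ∧ C ^ 2 < γ := by
    refine ⟨Real.sqrt ((Cinv ^ 2 + γ) / 2), Real.lt_sqrt_of_sq_lt (by linarith), ?_⟩
    rw [Real.sq_sqrt (by positivity)]
    linarith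
  have hc : 0 < 1 - C ^ 2 / γ := by
    rw [sub_pos, div_lt_one hγ0]
    exact hCγ
  set c := 1 - C ^ 2 / γ with hcdef
  refine ⟨c⁻¹, inv_pos.2 hc, ?_⟩
  intro N G κ f hκm hκ1 hκB _ hinv M₁ M₂ φ lam₁ ξ lam₂ hφ hξ l₁ l₂ uh uH huh huH
  have hκ : G.IsCoefficient κ := ⟨hκm, hκ1, hκB⟩
  have hC : G.invConst κ < C := hinv.trans_lt hCC
  have ha := hκ.isPSDOn_aDG hC hCγ
  have hsnap1 : ∀ i, G.Vsnap1 κ i ≤ G.Vh i := fun i =>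
    (hκ.Vsnap1_le_harmonic i).trans (hκ.harmonic_le_Vh i)
  have hsnap2 : ∀ i, G.Vsnap2 i ≤ G.Vh i := GMsDGM.TwoGrid.Vh0_le_Vh
  have huHV : uH ∈ G.VDG := by
    refine GMsDGM.TwoGrid.mem_VDG.2 fun i => ?_
    refine (sup_le ?_ ?_ : GMsDGM.firstSpan (φ i) (l₁ i) ⊔ GMsDGM.firstSpan (ξ i) (l₂ i)
      ≤ G.Vh i) (Submodule.mem_pi.1 huH.1 i (mem_univ i))
    · exact (GMsDGM.firstSpan_le (hφ i).span_eq _).trans (hsnap1 i)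
    · exact (GMsDGM.firstSpan_le (hξ i).span_eq _).trans (hsnap2 i)
  set e := uh - uH with he
  have heV : e ∈ G.VDG := sub_mem huh.1 huHV
  have hei := GMsDGM.TwoGrid.mem_VDG.1 heV
  set R := G.residual κ γ f uH with hR
  -- The error equation: the source term is replaced by `a_DG(uh, ·)`. Additivity of the residual is
  -- then inherited from the form.
  have hRa : ∀ i, ∀ v ∈ G.Vh i, R i v = G.aDG κ γ e (Pi.single i v) := by
    intro i v hv
    have hs := GMsDGM.TwoGrid.single_mem_VDG hv
    rw [he, ha.sub_left huh.1 huHV hs, huh.2 _ hs, GMsDGM.TwoGrid.sum_source_single]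
    rfl
  have hRadd : ∀ i, ∀ u ∈ G.Vh i, ∀ v ∈ G.Vh i, R i (u + v) = R i u + R i v := by
    intro i u hu v hv
    rw [hRa i _ (add_mem hu hv), hRa i u hu, hRa i v hv, Pi.single_add,
      ha.add_right heV (GMsDGM.TwoGrid.single_mem_VDG hu) (GMsDGM.TwoGrid.single_mem_VDG hv)]
  have hRoff : ∀ i, ∀ p ∈ GMsDGM.firstSpan (φ i) (l₁ i) ⊔ GMsDGM.firstSpan (ξ i) (l₂ i),
      R i p = 0 := fun i p hp =>
    huH.residual_eq_zero (GMsDGM.TwoGrid.single_mem_Voff hp)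
  have hRsub : ∀ i, ∀ v ∈ G.Vh i, ∀ p ∈ G.Vh i, R i p = 0 → R i (v - p) = R i v := by
    intro i v hv p hp h0
    have := hRadd i (v - p) (sub_mem hv hp) p hp
    rw [sub_add_cancel, h0, add_zero] at this
    exact this.symm
  have hR0 : ∀ i, R i 0 = 0 := fun i => hRoff i 0 (zero_mem _)
  have hsum : G.aDG κ γ e e = ∑ i, R i (e i) := by
    have h1 : (⟨e, heV⟩ : G.VDG)
        = ∑ i, ⟨Pi.single i (e i), GMsDGM.TwoGrid.single_mem_VDG (hei i)⟩ := by
      refine Subtype.ext ?_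
      rw [Submodule.coe_sum]
      exact (Finset.univ_sum_single e).symm
    have h2 := congr_arg (ha.toBilin ⟨e, heV⟩) h1
    rw [map_sum] at h2
    refine h2.trans (Finset.sum_congr rfl fun i _ => ?_)
    exact (hRa i _ (hei i)).symm
  set X₁ : Fin N → ℝ≥0∞ := fun i => GMsDGM.dualNorm (G.Vsnap1 κ i) (G.form1 κ i) (R i) ^ 2 *
    (GMsDGM.nextEigenvalue (lam₁ i) (l₁ i))⁻¹ with hX₁
  set X₂ : Fin N → ℝ≥0∞ := fun i => GMsDGM.dualNorm (G.Vsnap2 i) (G.form2 κ i) (R i) ^ 2 *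
    (GMsDGM.nextEigenvalue (lam₂ i) (l₂ i))⁻¹ with hX₂
  change _ ≤ ENNReal.ofReal c⁻¹ * ∑ i, (X₁ i + X₂ i)
  -- The constant is positive, so an infinite sum makes the bound trivial. Otherwise every term is
  -- finite and the estimate is one between real numbers.
  by_cases htop : ∑ i, (X₁ i + X₂ i) = ⊤
  · rw [htop, ENNReal.mul_top (ENNReal.ofReal_pos.2 (inv_pos.2 hc)).ne']
    exact le_top
  have hfin : ∀ i, X₁ i ≠ ⊤ ∧ X₂ i ≠ ⊤ := fun i =>
    ENNReal.add_ne_top.1 (ENNReal.sum_ne_top.1 htop i (Finset.mem_univ i))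
  have hlocal : ∀ i, 2 * R i (e i)
      ≤ c⁻¹ * ((X₁ i).toReal + (X₂ i).toReal) + c * G.energy κ i (e i) (e i) := by
    intro i
    have hE := hκ.isPSDOn_energy i
    obtain ⟨v₁, hv₁, v₂, hv₂, hv, hEv⟩ := hκ.exists_snapshot_decomposition (hei i)
    have h₁ : R i v₁ ^ 2 ≤ (X₁ i).toReal * G.energy κ i v₁ v₁ :=
      GMsDGM.sq_le_of_isEigenbasis (hE.mono (hsnap1 i))
        ((hκ.isPSDOn_form1 i).mono ((hsnap1 i).trans (G.Vh_le_boundedMeasurable i)))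
        (hφ i) (l₁ i) (hR0 i)
        (fun v hv p hp => hRsub i v (hsnap1 i hv) p
          (hsnap1 i (GMsDGM.firstSpan_le (hφ i).span_eq _ hp))
          (hRoff i p (Submodule.mem_sup_left hp))) (hfin i).1 hv₁
    have h₂ : R i v₂ ^ 2 ≤ (X₂ i).toReal * G.energy κ i v₂ v₂ :=
      GMsDGM.sq_le_of_isEigenbasis (hE.mono (hsnap2 i))
        ((hκ.isPSDOn_form2 i).mono ((hsnap2 i).trans (G.Vh_le_boundedMeasurable i)))
        (hξ i) (l₂ i) (hR0 i)
        (fun v hv p hp => hRsub i v (hsnap2 i hv) p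
          (hsnap2 i (GMsDGM.firstSpan_le (hξ i).span_eq _ hp))
          (hRoff i p (Submodule.mem_sup_right hp))) (hfin i).2 hv₂
    have y₁ := GMsDGM.two_mul_le_of_sq_le hc ENNReal.toReal_nonneg
      (hE.nonneg v₁ (hsnap1 i hv₁)) h₁
    have y₂ := GMsDGM.two_mul_le_of_sq_le hc ENNReal.toReal_nonneg
      (hE.nonneg v₂ (hsnap2 i hv₂)) h₂
    rw [hEv, hv, hRadd i v₁ (hsnap1 i hv₁) v₂ (hsnap2 i hv₂)]
    linarith
  have hreal : G.aDG κ γ e e ≤ c⁻¹ * ∑ i, ((X₁ i).toReal + (X₂ i).toReal) := by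
    have h1 := Finset.sum_le_sum fun i (_ : i ∈ Finset.univ) => hlocal i
    rw [Finset.sum_add_distrib, ← Finset.mul_sum, ← Finset.mul_sum, ← Finset.mul_sum, ← hsum]
      at h1
    -- The summed local bounds estimate `2 a_DG(e, e)`; coercivity bounds their energy part by one
    -- copy of `a_DG(e, e)`, which is absorbed on the left.
    have h2 := hκ.aDG_coercive hC hCγ heV
    linarith
  refine (ENNReal.ofReal_le_ofReal hreal).trans (le_of_eq ?_)
  rw [ENNReal.ofReal_mul (inv_nonneg.2 hc.le), ENNReal.ofReal_sum_of_nonneg fun i _ =>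
    add_nonneg ENNReal.toReal_nonneg ENNReal.toReal_nonneg]
  congr 1
  refine Finset.sum_congr rfl fun i _ => ?_
  rw [ENNReal.ofReal_add ENNReal.toReal_nonneg ENNReal.toReal_nonneg,
    ENNReal.ofReal_toReal (hfin i).1, ENNReal.ofReal_toReal (hfin i).2]
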